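/- Let $d_1,d_2,d_Y\ge 0$ be integers and let $\Delta$ be the set of Borel probability measures on $\mathbb{R}^{d_1}\times\mathbb{R}^{d_2}\times\mathbb{R}^{d_Y}$, regarded as laws of random vectors $(X_1,X_2,Y)$. "Gaussian" includes degenerate Gaussian laws. For $q\in\Delta$, with $X=(X_1,X_2)$, let $$h_q(Y|X_1,X_2)=-\int q_X(dx)\int f(y|x)\log f(y|x)\,dy\in[-\infty,\infty],$$ where $f(y|x)$ is the density of $q$ with respect to $q_X\otimes\mathrm{Lebesgue}$, and $h_q(Y|X_1,X_2)=-\infty$ if there is no such density. Let $I_q(X_1,X_2;Y)$, $I_q(X_i;Y)$ and $I_q(X_i;Y|X_j)$ be the (conditional) mutual informations under $q$, with values in $[0,\infty]$, and let $I_q(X_1;X_2;Y)=I_q(X_1;Y)-I_q(X_1;Y|X_2)$. (a) Let $q\in\Delta$ have finite first and second moments. Then there is a jointly Gaussian law with the same mean and covariance as $q$, and for such a law $\hat q$, $$h_q(Y|X_1,X_2)\le h_{\hat q}(Y|X_1,X_2).$$ (b) Let $p\in\Delta$ be such that the marginal laws $p(x_1,y)$ and $p(x_2,y)$ are Gaussian,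 and let $\Delta_p^{\mathrm G}$ be the set of all $q\in\Delta$ with $q(x_1,y)=p(x_1,y)$ and $q(x_2,y)=p(x_2,y)$. Then each of the problems $$\min_{q\in\Delta_p^{\mathrm G}} I_q(X_1,X_2;Y),\quad \min_{q\in\Delta_p^{\mathrm G}} I_q(X_1;Y|X_2),\quad \min_{q\in\Delta_p^{\mathrm G}} I_q(X_2;Y|X_1),\quad \max_{q\in\Delta_p^{\mathrm G}} I_q(X_1;X_2;Y)$$ has an optimizer that is jointly Gaussian. Consequently the GPID values $$R=\max_{q} I_q(X_1;X_2;Y),\quad U_1=\min_{q} I_q(X_1;Y|X_2),\quad U_2=\min_{q} I_q(X_2;Y|X_1),\quad S=I_p(X_1,X_2;Y)-\min_{q} I_q(X_1,X_2;Y),$$ with $q$ ranging over $\Delta_p^{\mathrm G}$, are equal to the corresponding $\sim_G$-PID values, in which $q$ ranges only over the jointly Gaussian members of $\Delta_p^{\mathrm G}$. (If informations are infinite, differences are read with the convention $\infty-\infty=-\infty$.) -/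

import Mathlib

open MeasureTheory ProbabilityTheory InformationTheory
open scoped ENNReal

namespace GPID

noncomputable section

/-! ### Information measures (natural logarithm) of random variables -/

section Information

variable {Ω A B C : Type*} [MeasurableSpace Ω] [MeasurableSpace A] [MeasurableSpace B]
  [MeasurableSpace C]

/-- The conditional density `f(y | x)`: the Radon-Nikodym density of the joint law of `(X, Y)` with
respect to `P_X ⊗ Lebesgue`. The law of `X` itself need not have a density. -/
def condDensity {n : ℕ} (P : Measure Ω) (Y : Ω → EuclideanSpace ℝ (Fin n)) (X : Ω → A) :
    A × EuclideanSpace ℝ (Fin n) → ℝ≥0∞ :=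
  (P.map fun ω => (X ω, Y ω)).rnDeriv ((P.map X).prod volume)

open Classical in
/-- The conditional differential entropy
`h(Y | X) = - ∫ P_X(dx) ∫ f(y | x) log f(y | x) dy`, as an extended real number: the integral of the
positive part of `- f log f` minus the integral of its negative part. It is `-∞` if `(X, Y)` is not
absolutely continuous with respect to `P_X ⊗ Lebesgue`, that is, if the conditional law of `Y`
given `X` fails to have a density with positive probability. -/
def condDiffEntropy {n : ℕ} (P : Measure Ω) (Y : Ω → EuclideanSpace ℝ (Fin n)) (X : Ω → A) :
    EReal :=
  if (P.map fun ω => (X ω, Y ω)) ≪ (P.map X).prod volume then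
    ((∫⁻ z, ENNReal.ofReal (Real.negMulLog (condDensity P Y X z).toReal)
        ∂((P.map X).prod volume) : ℝ≥0∞) : EReal)
      - ((∫⁻ z, ENNReal.ofReal (-Real.negMulLog (condDensity P Y X z).toReal)
        ∂((P.map X).prod volume) : ℝ≥0∞) : EReal)
  else ⊥

/-- The mutual information `I(X; Y) = D(P_{XY} ‖ P_X ⊗ P_Y)`. -/
def mutualInfo (P : Measure Ω) (X : Ω → A) (Y : Ω → B) : ℝ≥0∞ :=
  klDiv (P.map fun ω => (X ω, Y ω)) ((P.map X).prod (P.map Y))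

/-- The conditional mutual information
`I(X; Y | Z) = D(P_{ZXY} ‖ P_Z ⊗ (P_{X|Z} ⊗ P_{Y|Z}))`. -/
def condMutualInfo [StandardBorelSpace A] [Nonempty A] [StandardBorelSpace B] [Nonempty B]
    (P : Measure Ω) [IsFiniteMeasure P] (X : Ω → A) (Y : Ω → B) (Z : Ω → C) : ℝ≥0∞ :=
  klDiv (P.map fun ω => (Z ω, X ω, Y ω))
    ((P.map Z) ⊗ₘ (condDistrib X Z P ×ₖ condDistrib Y Z P))

end Information

/-! ### Joint distributions of `(X₁, X₂, Y)` -/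

/-- The space of values `(x₁, x₂, y)`. -/
abbrev Triple (d₁ d₂ dY : ℕ) : Type :=
  EuclideanSpace ℝ (Fin d₁) × EuclideanSpace ℝ (Fin d₂) × EuclideanSpace ℝ (Fin dY)

/-- The set of joint distributions of `(X₁, X₂, Y)`. -/
abbrev Law (d₁ d₂ dY : ℕ) : Type := ProbabilityMeasure (Triple d₁ d₂ dY)

section Objectives

variable {d₁ d₂ dY : ℕ}

/-- The random vector `X₁`. -/
def X₁ (z : Triple d₁ d₂ dY) : EuclideanSpace ℝ (Fin d₁) := z.1

/-- The random vector `X₂`. -/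
def X₂ (z : Triple d₁ d₂ dY) : EuclideanSpace ℝ (Fin d₂) := z.2.1

/-- The random vector `Y`. -/
def Y (z : Triple d₁ d₂ dY) : EuclideanSpace ℝ (Fin dY) := z.2.2

/-- `h_q(Y | X₁, X₂)`. -/
def entropyYGivenX (q : Law d₁ d₂ dY) : EReal :=
  condDiffEntropy (q : Measure (Triple d₁ d₂ dY)) Y (fun z => (X₁ z, X₂ z))

/-- `I_q(X₁, X₂; Y)`. -/
def totalInfo (q : Law d₁ d₂ dY) : ℝ≥0∞ :=
  mutualInfo (q : Measure (Triple d₁ d₂ dY)) (fun z => (X₁ z, X₂ z)) Y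

/-- `I_q(X₁; Y | X₂)`. -/
def condInfo₁ (q : Law d₁ d₂ dY) : ℝ≥0∞ :=
  condMutualInfo (q : Measure (Triple d₁ d₂ dY)) X₁ Y X₂

/-- `I_q(X₂; Y | X₁)`. -/
def condInfo₂ (q : Law d₁ d₂ dY) : ℝ≥0∞ :=
  condMutualInfo (q : Measure (Triple d₁ d₂ dY)) X₂ Y X₁

/-- The three-way mutual information `I_q(X₁; X₂; Y) = I_q(X₁; Y) - I_q(X₁; Y | X₂)`. -/
def interactionInfo (q : Law d₁ d₂ dY) : EReal :=
  (mutualInfo (q : Measure (Triple d₁ d₂ dY)) X₁ Y : EReal) - (condInfo₁ q : EReal)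

/-- `q` is jointly Gaussian (possibly degenerate). -/
def IsJointlyGaussian (q : Law d₁ d₂ dY) : Prop :=
  IsGaussian (q : Measure (Triple d₁ d₂ dY))

/-- `q` has finite first and second moments. -/
def HasFiniteMoments (q : Law d₁ d₂ dY) : Prop :=
  MemLp id 2 (q : Measure (Triple d₁ d₂ dY))

/-- `q'` is jointly Gaussian with the same mean and the same covariance as `q`. -/
def IsGaussianMatch (q q' : Law d₁ d₂ dY) : Prop :=
  IsJointlyGaussian q' ∧
  (∫ z, z ∂(q' : Measure (Triple d₁ d₂ dY))) = ∫ z, z ∂(q : Measure (Triple d₁ d₂ dY)) ∧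
  covarianceBilinDual (q' : Measure (Triple d₁ d₂ dY)) =
    covarianceBilinDual (q : Measure (Triple d₁ d₂ dY))

/-! ### Partial information decompositions -/

/-- The law of `(X₁, Y)` under `q`. -/
def marginal₁ (q : Law d₁ d₂ dY) :
    Measure (EuclideanSpace ℝ (Fin d₁) × EuclideanSpace ℝ (Fin dY)) :=
  (q : Measure (Triple d₁ d₂ dY)).map fun z => (X₁ z, Y z)

/-- The law of `(X₂, Y)` under `q`. -/
def marginal₂ (q : Law d₁ d₂ dY) :
    Measure (EuclideanSpace ℝ (Fin d₂) × EuclideanSpace ℝ (Fin dY)) :=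
  (q : Measure (Triple d₁ d₂ dY)).map fun z => (X₂ z, Y z)

/-- `Δ^G`: the laws whose pairwise marginals of `(X₁, Y)` and of `(X₂, Y)` are Gaussian. -/
def pairwiseGaussian (d₁ d₂ dY : ℕ) : Set (Law d₁ d₂ dY) :=
  {q | IsGaussian (marginal₁ q) ∧ IsGaussian (marginal₂ q)}

/-- `Δ_p^G`: the laws in `Δ^G` with the same pairwise marginals as `p`. -/
def feasible (p : Law d₁ d₂ dY) : Set (Law d₁ d₂ dY) :=
  {q | q ∈ pairwiseGaussian d₁ d₂ dY ∧ marginal₁ q = marginal₁ p ∧ marginal₂ q = marginal₂ p}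

/-- The jointly Gaussian laws with the same pairwise marginals as `p`. -/
def gaussianFeasible (p : Law d₁ d₂ dY) : Set (Law d₁ d₂ dY) :=
  {q | IsJointlyGaussian q ∧ marginal₁ q = marginal₁ p ∧ marginal₂ q = marginal₂ p}

/-- The four values of a partial information decomposition. -/
@[ext]
structure Decomposition where
  /-- redundant information -/
  R : EReal
  /-- information unique to `X₁` -/
  U₁ : EReal
  /-- information unique to `X₂` -/
  U₂ : EReal
  /-- synergistic information -/
  S : EReal

/-- The decomposition of `I_p(X₁, X₂; Y)` obtained by optimizing over a set `D` of laws. -/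
def decomposition (p : Law d₁ d₂ dY) (D : Set (Law d₁ d₂ dY)) : Decomposition where
  R := ⨆ q ∈ D, interactionInfo q
  U₁ := ⨅ q ∈ D, (condInfo₁ q : EReal)
  U₂ := ⨅ q ∈ D, (condInfo₂ q : EReal)
  S := (totalInfo p : EReal) - ⨅ q ∈ D, (totalInfo q : EReal)

/-- GPID: optimization over all laws in `Δ_p^G`. -/
def gpid (p : Law d₁ d₂ dY) : Decomposition := decomposition p (feasible p)

/-- `∼_G`-PID: optimization restricted to jointly Gaussian laws. -/
def tildeGpid (p : Law d₁ d₂ dY) : Decomposition := decomposition p (gaussianFeasible p)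

end Objectives

end

end GPID

open MeasureTheory ProbabilityTheory InformationTheory
open scoped ENNReal

set_option linter.unusedSectionVars false
set_option maxSynthPendingDepth 3

namespace GPID

noncomputable section

/-! ### Kullback-Leibler divergence and exponential tilting -/

section Tilting

variable {α β : Type*} [MeasurableSpace α] [MeasurableSpace β]

/-! Everything reduces to one functional: the divergence of the law `π` of `(x, w)` from `π_x ⊗ N(0,
1)`. A Gaussian regression model `θ` of `w` given `x` defines a tilt of `π_x ⊗ N(0, 1)` whose
log-density, the score, is quadratic. By the Donsker-Varadhan inequality the expected score bounds
the divergence from below, and it depends on `π` only through its mean and covariance. If `π` is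
Gaussian, the supremum over `θ` equals the divergence (`klDiv_eq_iSup_score`): a nondegenerate
residual makes the true regression optimal, and a degenerate one makes both sides infinite. Hence a
Gaussian law has the least divergence among laws with its moments (`affineDiv_le_of_moments_eq`). No
covariance has to be inverted and no determinant formula is needed, so degenerate laws are covered.

For (a), `h(Y|X)` is a function of the moments minus this divergence (`entropyYGivenX_eq`).

For (b), each minimized information is a divergence of this kind, after a transformation of `Y` that
is the same for all feasible laws. For `I(X₁,X₂;Y)` the law of `Y` is whitened; for `I(X₁;Y|X₂)` the
regression of `Y` on `X₂` is subtracted first, which gives `I(X₂,X₁; Y - A X₂)`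
(`condMutualInfo_eq_mutualInfo`). The mean is constant on the feasible set and the covariances lie
in a compact set (`isCompact_covSet`). The lower bound is a supremum of continuous functions of the
covariance, hence lower semicontinuous, and attains its minimum. The Gaussian law with the
minimizing covariance is feasible, because its pairwise marginals are Gaussian with the prescribed
moments. Finally `I(X₁;Y)` is constant on the feasible set, so maximizing the interaction
information is minimizing `I(X₁;Y|X₂)`. -/

/-- The easy half of the Donsker-Varadhan formula. -/
theorem ofReal_integral_le_klDiv {μ ν : Measure α} [IsProbabilityMeasure μ]
    [IsProbabilityMeasure ν] {f : α → ℝ} (hf : Integrable f μ)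
    (hexp : Integrable (fun x => Real.exp (f x)) ν) (h1 : ∫ x, Real.exp (f x) ∂ν = 1) :
    ENNReal.ofReal (∫ x, f x ∂μ) ≤ klDiv μ ν := by
  by_cases htop : klDiv μ ν = ∞
  · simp [htop]
  obtain ⟨hac, hInt⟩ := klDiv_ne_top_iff.1 htop
  have : IsProbabilityMeasure (ν.tilted f) := isProbabilityMeasure_tilted hexp
  have hac' : μ ≪ ν.tilted f := hac.trans (absolutelyContinuous_tilted hexp)
  -- Gibbs' inequality for `μ` against the tilted measure: the log-likelihood ratio is that of `μ`
  -- against `ν` minus `f`, and the normalizing constant vanishes by `h1`.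
  have key := integral_llr_add_sub_measure_univ_nonneg hac'
    (integrable_llr_tilted_right hac hf hInt hexp)
  rw [integral_llr_tilted_right hac hf hexp hInt, h1] at key
  rw [klDiv_of_ac_of_integrable hac hInt]
  apply ENNReal.ofReal_le_ofReal
  simp at key ⊢
  linarith

theorem tilted_eq_withDensity_exp {ν : Measure α} {f : α → ℝ}
    (h1 : ∫ x, Real.exp (f x) ∂ν = 1) :
    ν.tilted f = ν.withDensity fun x => ENNReal.ofReal (Real.exp (f x)) := by
  simp [Measure.tilted, h1]

/-- The equality case of the bound above: for the tilt itself the log-likelihood ratio is `f`. -/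
theorem klDiv_withDensity_exp {ν : Measure α} [IsProbabilityMeasure ν] {f : α → ℝ}
    (hexp : Integrable (fun x => Real.exp (f x)) ν) (h1 : ∫ x, Real.exp (f x) ∂ν = 1)
    (hf : Integrable f (ν.withDensity fun x => ENNReal.ofReal (Real.exp (f x)))) :
    klDiv (ν.withDensity fun x => ENNReal.ofReal (Real.exp (f x))) ν =
      ENNReal.ofReal (∫ x, f x ∂(ν.withDensity fun x => ENNReal.ofReal (Real.exp (f x)))) := by
  rw [← tilted_eq_withDensity_exp h1] at hf ⊢
  have : IsProbabilityMeasure (ν.tilted f) := isProbabilityMeasure_tilted hexp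
  have hac := tilted_absolutelyContinuous ν f
  have hllr : llr (ν.tilted f) ν =ᵐ[ν.tilted f] f := by
    filter_upwards [hac.ae_le (log_rnDeriv_tilted_left_self hexp)] with x hx
    rw [llr, hx, h1]
    simp
  rw [klDiv_of_ac_of_integrable hac (hf.congr hllr.symm), integral_congr_ae hllr]
  simp

/-- Data processing applied to `g` and to `g'`. An almost sure inverse has to suffice, since
whitening a degenerate Gaussian is invertible only on its support. -/
theorem klDiv_map_eq_of_ae_leftInverse {μ ν : Measure α} [IsFiniteMeasure μ] [IsFiniteMeasure ν]
    {g : α → β} {g' : β → α} (hg : Measurable g) (hg' : Measurable g')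
    (hμ : ∀ᵐ x ∂μ, g' (g x) = x) (hν : ∀ᵐ x ∂ν, g' (g x) = x) :
    klDiv (μ.map g) (ν.map g) = klDiv μ ν := by
  refine le_antisymm (klDiv_map_le μ ν hg) ?_
  have h {ρ : Measure α} (hρ : ∀ᵐ x ∂ρ, g' (g x) = x) : (ρ.map g).map g' = ρ := by
    rw [Measure.map_map hg' hg]
    calc ρ.map (g' ∘ g) = ρ.map id := Measure.map_congr hρ
      _ = ρ := Measure.map_id
  calc klDiv μ ν = klDiv ((μ.map g).map g') ((ν.map g).map g') := by rw [h hμ, h hν]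
    _ ≤ _ := klDiv_map_le _ _ hg'

end Tilting

/-! ### The density of the standard Gaussian measure -/

section Density

variable {n : ℕ}

/-- The density of the standard Gaussian measure on `ℝⁿ`. -/
def stdGaussianDensity (w : EuclideanSpace ℝ (Fin n)) : ℝ :=
  (2 * Real.pi) ^ (-(n / 2 : ℝ)) * Real.exp (-(1 / 2) * ‖w‖ ^ 2)

theorem stdGaussianDensity_pos (w : EuclideanSpace ℝ (Fin n)) : 0 < stdGaussianDensity w := by
  unfold stdGaussianDensity; positivity

@[fun_prop]
theorem measurable_stdGaussianDensity :
    Measurable (stdGaussianDensity : EuclideanSpace ℝ (Fin n) → ℝ) := by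
  unfold stdGaussianDensity; fun_prop

theorem log_stdGaussianDensity (w : EuclideanSpace ℝ (Fin n)) :
    Real.log (stdGaussianDensity w) =
      -(n / 2 : ℝ) * Real.log (2 * Real.pi) - (1 / 2) * ‖w‖ ^ 2 := by
  unfold stdGaussianDensity
  rw [Real.log_mul (by positivity) (by positivity), Real.log_exp, Real.log_rpow (by positivity)]
  ring

theorem integral_stdGaussianDensity_smul_cexp (t : EuclideanSpace ℝ (Fin n)) :
    ∫ w : EuclideanSpace ℝ (Fin n), stdGaussianDensity w • Complex.exp (inner ℝ w t * Complex.I) =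
      Complex.exp (-‖t‖ ^ 2 / 2) := by
  have h := GaussianFourier.integral_cexp_neg_mul_sq_norm_add_of_euclideanSpace
    (b := 1 / 2) (by norm_num) Complex.I t
  have h2 : ∀ w : EuclideanSpace ℝ (Fin n),
      stdGaussianDensity w • Complex.exp (inner ℝ w t * Complex.I) =
      ((2 * Real.pi : ℝ) : ℂ) ^ (-(n / 2 : ℂ)) *
        Complex.exp (-(1 / 2) * ‖w‖ ^ 2 + Complex.I * inner ℝ t w) := by
    intro w
    rw [Complex.real_smul, stdGaussianDensity, Complex.exp_add, Complex.ofReal_mul,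
      Complex.ofReal_cpow (by positivity), real_inner_comm, mul_comm Complex.I]
    push_cast
    ring
  simp_rw [h2]
  rw [integral_const_mul, h]
  simp only [Fintype.card_fin, Complex.I_sq]
  have h3 : ((Real.pi : ℂ) / (1 / 2)) = ((2 * Real.pi : ℝ) : ℂ) := by push_cast; ring
  have h4 : ((2 * Real.pi : ℝ) : ℂ) ≠ 0 := by
    exact_mod_cast (by positivity : (2 * Real.pi : ℝ) ≠ 0)
  rw [h3, ← mul_assoc, ← Complex.cpow_add _ _ h4]
  simp
  ring_nf

theorem integrable_stdGaussianDensity :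
    -- Otherwise the Bochner integral would be `0` by convention, while the Fourier transform at `0`
    -- equals `1`.
    Integrable (stdGaussianDensity : EuclideanSpace ℝ (Fin n) → ℝ) := by
  by_contra hcon
  have h := integral_stdGaussianDensity_smul_cexp (0 : EuclideanSpace ℝ (Fin n))
  simp only [inner_zero_right, Complex.ofReal_zero, zero_mul, Complex.exp_zero] at h
  rw [integral_undef] at h
  · simp at h
  · intro hInt
    apply hcon
    refine hInt.re.congr (Filter.Eventually.of_forall fun w => ?_)
    simp

theorem stdGaussian_eq_withDensity :
    stdGaussian (EuclideanSpace ℝ (Fin n)) =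
      volume.withDensity fun w => ENNReal.ofReal (stdGaussianDensity w) := by
  have : IsFiniteMeasure ((volume : Measure (EuclideanSpace ℝ (Fin n))).withDensity
      fun w => ENNReal.ofReal (stdGaussianDensity w)) :=
    isFiniteMeasure_withDensity_ofReal integrable_stdGaussianDensity.2
  apply Measure.ext_of_charFun
  ext t
  rw [charFun_stdGaussian, charFun_apply, integral_withDensity_eq_integral_toReal_smul
    measurable_stdGaussianDensity.ennreal_ofReal (by simp)]
  simp_rw [ENNReal.toReal_ofReal (stdGaussianDensity_pos _).le]
  rw [integral_stdGaussianDensity_smul_cexp]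

end Density

/-! ### Gaussian regression models and their log-likelihood ratios -/

/-- A conditional law of `w ∈ ℝⁿ` given `x`, under which `scale w - slope x - shift` is standard
Gaussian. -/
structure RegressionModel (F : Type*) [NormedAddCommGroup F] [NormedSpace ℝ F] (n : ℕ) where
  /-- the linear transformation that whitens the residual -/
  scale : EuclideanSpace ℝ (Fin n) ≃L[ℝ] EuclideanSpace ℝ (Fin n)
  /-- the (whitened) regression coefficients -/
  slope : F →L[ℝ] EuclideanSpace ℝ (Fin n)
  /-- the (whitened) intercept -/
  shift : EuclideanSpace ℝ (Fin n)

namespace RegressionModel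

variable {F : Type*} [NormedAddCommGroup F] [NormedSpace ℝ F] {n : ℕ} (θ : RegressionModel F n)

/-- The whitened residual. -/
def residual (z : F × EuclideanSpace ℝ (Fin n)) : EuclideanSpace ℝ (Fin n) :=
  θ.scale z.2 - (θ.slope z.1 + θ.shift)

/-- The response with a given whitened residual. -/
def sample (z : F × EuclideanSpace ℝ (Fin n)) : F × EuclideanSpace ℝ (Fin n) :=
  (z.1, θ.scale.symm (z.2 + (θ.slope z.1 + θ.shift)))

/-- The determinant of `θ.scale`. -/
def scaleDet : ℝ :=
  LinearMap.det (θ.scale.toLinearEquiv : EuclideanSpace ℝ (Fin n) →ₗ[ℝ] EuclideanSpace ℝ (Fin n))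

/-- The logarithm of the density of the conditional law `θ` with respect to the standard Gaussian
measure. -/
def score (z : F × EuclideanSpace ℝ (Fin n)) : ℝ :=
  Real.log |θ.scaleDet| - (1 / 2) * ‖θ.residual z‖ ^ 2 + (1 / 2) * ‖z.2‖ ^ 2

theorem scaleDet_ne_zero : θ.scaleDet ≠ 0 :=
  (LinearEquiv.isUnit_det' θ.scale.toLinearEquiv).ne_zero

theorem exp_score_mul_stdGaussianDensity (x : F) (w : EuclideanSpace ℝ (Fin n)) :
    Real.exp (θ.score (x, w)) * stdGaussianDensity w =
      |θ.scaleDet| *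
        stdGaussianDensity (θ.scale w - (θ.slope x + θ.shift)) := by
  have h : 0 < |θ.scaleDet| :=
    abs_pos.2 θ.scaleDet_ne_zero
  rw [← Real.log_injOn_pos.eq_iff (Set.mem_Ioi.2 (mul_pos (Real.exp_pos _)
    (stdGaussianDensity_pos _))) (Set.mem_Ioi.2 (mul_pos h (stdGaussianDensity_pos _))),
    Real.log_mul (Real.exp_pos _).ne' (stdGaussianDensity_pos _).ne',
    Real.log_mul h.ne' (stdGaussianDensity_pos _).ne', Real.log_exp, log_stdGaussianDensity,
    log_stdGaussianDensity, score, residual]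
  ring

theorem lintegral_comp_scale_sub (c : EuclideanSpace ℝ (Fin n))
    {h : EuclideanSpace ℝ (Fin n) → ℝ≥0∞} (hh : Measurable h) :
    ENNReal.ofReal |θ.scaleDet| *
      ∫⁻ w, h (θ.scale w - c) = ∫⁻ v, h v := by
  have h1 : ∫⁻ w, h (θ.scale w - c) =
      ∫⁻ v, h (v - c) ∂(Measure.map
        (θ.scale.toLinearEquiv : EuclideanSpace ℝ (Fin n) →ₗ[ℝ] EuclideanSpace ℝ (Fin n)) volume) := by
    rw [lintegral_map (by fun_prop) (by exact θ.scale.continuous.measurable)]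
    rfl
  rw [h1, Measure.map_linearMap_addHaar_eq_smul_addHaar _ θ.scaleDet_ne_zero, lintegral_smul_measure,
    lintegral_sub_right_eq_self h c, smul_eq_mul, ← mul_assoc, ← ENNReal.ofReal_mul (abs_nonneg _),
    ← abs_mul]
  change ENNReal.ofReal |θ.scaleDet * θ.scaleDet⁻¹| * _ = _
  rw [mul_inv_cancel₀ θ.scaleDet_ne_zero]
  simp

variable [MeasurableSpace F] [BorelSpace F]

@[fun_prop]
theorem measurable_residual : Measurable θ.residual := by unfold residual; fun_prop

@[fun_prop]
theorem measurable_score : Measurable θ.score := by unfold score; fun_prop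

@[fun_prop]
theorem measurable_sample : Measurable θ.sample := by unfold sample; fun_prop

/-- An affine change of variables in each fibre. Both sides are the joint law in which `x` has law
`ν` and `w` follows `θ` given `x`; as a pushforward it has total mass one when `ν` does, which
normalizes the tilt. -/
theorem map_sample_prod_stdGaussian (ν : Measure F) [SFinite ν] :
    (ν.prod (stdGaussian (EuclideanSpace ℝ (Fin n)))).map θ.sample =
      (ν.prod (stdGaussian _)).withDensity fun z => ENNReal.ofReal (Real.exp (θ.score z)) := by
  refine Measure.ext_of_lintegral _ fun f hf => ?_
  rw [lintegral_map hf θ.measurable_sample, lintegral_withDensity_eq_lintegral_mul _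
    θ.measurable_score.exp.ennreal_ofReal hf, lintegral_prod _ (by fun_prop),
    lintegral_prod _ (by fun_prop)]
  refine lintegral_congr fun x => ?_
  have hden : Measurable fun w : EuclideanSpace ℝ (Fin n) =>
    ENNReal.ofReal (stdGaussianDensity w) := measurable_stdGaussianDensity.ennreal_ofReal
  rw [stdGaussian_eq_withDensity, lintegral_withDensity_eq_lintegral_mul _ hden (by fun_prop),
    lintegral_withDensity_eq_lintegral_mul _ hden (by simp only [Pi.mul_apply]; fun_prop),
    ← θ.lintegral_comp_scale_sub (θ.slope x + θ.shift)
      (by simp only [Pi.mul_def]; fun_prop), ← lintegral_const_mul _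
      (by simp only [Pi.mul_apply]; fun_prop)]
  refine lintegral_congr fun w => ?_
  simp only [Pi.mul_apply, sample, sub_add_cancel, ContinuousLinearEquiv.symm_apply_apply]
  rw [← mul_assoc, ← mul_assoc, ← ENNReal.ofReal_mul (abs_nonneg _),
    ← θ.exp_score_mul_stdGaussianDensity, mul_comm (Real.exp _),
    ENNReal.ofReal_mul (stdGaussianDensity_pos _).le]

theorem integrable_exp_score (ν : Measure F) [IsProbabilityMeasure ν] :
    Integrable (fun z => Real.exp (θ.score z)) (ν.prod (stdGaussian _)) := by
  have h := congrArg (fun m => m Set.univ) (θ.map_sample_prod_stdGaussian ν)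
  refine ⟨by fun_prop, ?_⟩
  rw [hasFiniteIntegral_iff_ofReal (Filter.Eventually.of_forall fun _ => (Real.exp_pos _).le)]
  simp only [withDensity_apply _ MeasurableSet.univ, Measure.restrict_univ] at h
  rw [← h]
  exact measure_lt_top _ _

theorem integral_exp_score (ν : Measure F) [IsProbabilityMeasure ν] :
    ∫ z, Real.exp (θ.score z) ∂(ν.prod (stdGaussian _)) = 1 := by
  have h := congrArg (fun m => m Set.univ) (θ.map_sample_prod_stdGaussian ν)
  simp only [withDensity_apply _ MeasurableSet.univ, Measure.restrict_univ] at h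
  rw [integral_eq_lintegral_of_nonneg_ae (Filter.Eventually.of_forall fun _ => (Real.exp_pos _).le)
    (by fun_prop), ← h, Measure.map_apply θ.measurable_sample MeasurableSet.univ]
  simp

theorem integrable_score {π : Measure (F × EuclideanSpace ℝ (Fin n))} [IsProbabilityMeasure π]
    (hπ : MemLp id 2 π) : Integrable θ.score π := by
  have h1 : MemLp (fun z : F × EuclideanSpace ℝ (Fin n) => z.1) 2 π := hπ.fst
  have h2 : MemLp (fun z : F × EuclideanSpace ℝ (Fin n) => z.2) 2 π := hπ.snd
  have h3 : MemLp θ.residual 2 π := by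
    have h4 : MemLp (fun z : F × EuclideanSpace ℝ (Fin n) => θ.scale z.2) 2 π :=
      (θ.scale : EuclideanSpace ℝ (Fin n) →L[ℝ] EuclideanSpace ℝ (Fin n)).comp_memLp' h2
    have h5 : MemLp (fun z : F × EuclideanSpace ℝ (Fin n) => θ.slope z.1) 2 π :=
      θ.slope.comp_memLp' h1
    exact h4.sub (h5.add (memLp_const θ.shift))
  have h4 : Integrable (fun z => ‖θ.residual z‖ ^ 2) π := h3.integrable_norm_pow (by norm_num)
  have h5 : Integrable (fun z : F × EuclideanSpace ℝ (Fin n) => ‖z.2‖ ^ 2) π :=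
    h2.integrable_norm_pow (by norm_num)
  exact ((integrable_const _).sub (h4.const_mul _)).add (h5.const_mul _)

/-- Any regression model gives a lower bound on the divergence from `π_x ⊗ N(0, 1)`. -/
theorem ofReal_integral_score_le_klDiv {π : Measure (F × EuclideanSpace ℝ (Fin n))}
    [IsProbabilityMeasure π] (hπ : MemLp id 2 π) :
    ENNReal.ofReal (∫ z, θ.score z ∂π) ≤ klDiv π (π.fst.prod (stdGaussian _)) :=
  ofReal_integral_le_klDiv (θ.integrable_score hπ) (θ.integrable_exp_score _)
    (θ.integral_exp_score _)

/-- The lower bound is attained if the residual is standard Gaussian and independent of `x`. -/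
theorem klDiv_eq_ofReal_integral_score {π : Measure (F × EuclideanSpace ℝ (Fin n))}
    [IsProbabilityMeasure π] (hπ : MemLp id 2 π)
    (h : π.map (fun z => (z.1, θ.residual z)) = π.fst.prod (stdGaussian _)) :
    klDiv π (π.fst.prod (stdGaussian _)) = ENNReal.ofReal (∫ z, θ.score z ∂π) := by
  -- `θ.sample` inverts passage to the residual, so `π` is exactly the tilted measure.
  have hπ' : π = (π.fst.prod (stdGaussian _)).withDensity
      fun z => ENNReal.ofReal (Real.exp (θ.score z)) := by
    rw [← map_sample_prod_stdGaussian, ← h, Measure.map_map (by fun_prop) (by fun_prop)]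
    have : θ.sample ∘ (fun z => (z.1, θ.residual z)) = id := by
      ext1 z
      simp [sample, residual]
    rw [this, Measure.map_id]
  have := klDiv_withDensity_exp (θ.integrable_exp_score π.fst) (θ.integral_exp_score π.fst)
    (by rw [← hπ']; exact θ.integrable_score hπ)
  rwa [← hπ'] at this

end RegressionModel

/-! ### Factorization of positive semidefinite forms and Gaussian measures -/

section Factorization

variable {E F : Type*} [NormedAddCommGroup E] [NormedSpace ℝ E]
  [NormedAddCommGroup F] [NormedSpace ℝ F] [FiniteDimensional ℝ F]

/-- A form on the dual space is symmetric and positive semidefinite. -/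
def IsCovForm (β : StrongDual ℝ E →L[ℝ] StrongDual ℝ E →L[ℝ] ℝ) : Prop :=
  (∀ L₁ L₂, β L₁ L₂ = β L₂ L₁) ∧ ∀ L, 0 ≤ β L L

theorem IsCovForm.sq_le {β : StrongDual ℝ E →L[ℝ] StrongDual ℝ E →L[ℝ] ℝ} (hβ : IsCovForm β)
    (L₁ L₂ : StrongDual ℝ E) : β L₁ L₂ ^ 2 ≤ β L₁ L₁ * β L₂ L₂ := by
  have h := LinearMap.BilinForm.apply_mul_apply_le_of_forall_zero_le β.toBilinForm hβ.2 L₁ L₂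
  simp only [ContinuousLinearMap.toBilinForm_apply] at h
  rw [sq]
  nth_rw 2 [hβ.1]
  exact h

variable [FiniteDimensional ℝ E]

/-- An orthogonal basis `v` of the dual diagonalizes `β`; `e` is the basis of `E` whose dual basis
is `v`. -/
theorem exists_dual_bases_of_isCovForm {β : StrongDual ℝ E →L[ℝ] StrongDual ℝ E →L[ℝ] ℝ}
    (hβ : IsCovForm β) :
    ∃ (N : ℕ) (e : Module.Basis (Fin N) ℝ E) (d : Fin N → ℝ), (∀ i, 0 ≤ d i) ∧
      ∀ L₁ L₂, β L₁ L₂ = ∑ i, d i * (L₁ (e i) * L₂ (e i)) := by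
  have hsymm : LinearMap.IsSymm β.toBilinForm := ⟨fun x y => hβ.1 x y⟩
  have : Invertible (2 : ℝ) := invertibleOfNonzero two_ne_zero
  obtain ⟨v, hv⟩ := LinearMap.BilinForm.exists_orthogonal_basis hsymm
  let v' : Module.Basis _ ℝ (Module.Dual ℝ E) := v.map LinearMap.toContinuousLinearMap.symm
  let e := v'.dualBasis.map (Module.evalEquiv ℝ E).symm
  have hve : ∀ i j, v i (e j) = if i = j then 1 else 0 := by
    intro i j
    have h1 : v i (e j) = Module.evalEquiv ℝ E (e j) (v' i) := by simp [v']
    rw [h1]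
    simp only [e, Module.Basis.map_apply, LinearEquiv.apply_symm_apply]
    rw [Module.Basis.dualBasis_apply_self]
  have hexp : ∀ L : StrongDual ℝ E, L = ∑ i, L (e i) • v i := by
    intro L
    apply ContinuousLinearMap.coe_injective
    refine e.ext fun j => ?_
    simp [hve]
  refine ⟨_, e, fun i => β (v i) (v i), fun i => hβ.2 _, fun L₁ L₂ => ?_⟩
  conv_lhs => rw [hexp L₁, hexp L₂]
  simp only [map_sum, map_smul, sum_apply, smul_apply,
    smul_eq_mul]
  refine Finset.sum_congr rfl fun i _ => ?_
  rw [Finset.sum_eq_single i]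
  · ring
  · intro j _ hj
    have : β (v j) (v i) = 0 := hv hj
    simp [this]
  · simp

/-- A positive semidefinite form on the dual is the covariance of an injective image of a
standard Gaussian vector. -/
theorem IsCovForm.exists_factorization {β : StrongDual ℝ E →L[ℝ] StrongDual ℝ E →L[ℝ] ℝ}
    (hβ : IsCovForm β) :
    ∃ (k : ℕ) (T : EuclideanSpace ℝ (Fin k) →L[ℝ] E) (S : E →L[ℝ] EuclideanSpace ℝ (Fin k)),
      (∀ v, S (T v) = v) ∧
      ∀ L₁ L₂, β L₁ L₂ =
        ∑ i, L₁ (T (EuclideanSpace.single i 1)) * L₂ (T (EuclideanSpace.single i 1)) := by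
  classical
  obtain ⟨N, e, d, hd, hβe⟩ := exists_dual_bases_of_isCovForm hβ
  -- Directions of zero variance are discarded; this is what makes `T` injective.
  let f : Fin (Fintype.card {i // d i ≠ 0}) ≃ {i // d i ≠ 0} := (Fintype.equivFin _).symm
  let y : Fin (Fintype.card {i // d i ≠ 0}) → E := fun j => √(d (f j)) • e (f j)
  let T : EuclideanSpace ℝ (Fin (Fintype.card {i // d i ≠ 0})) →L[ℝ] E :=
    LinearMap.toContinuousLinearMap ((EuclideanSpace.basisFun _ ℝ).toBasis.constr ℝ y)
  have hTs : ∀ j, T (EuclideanSpace.single j 1) = y j := by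
    intro j
    simp [T]
  have hind : LinearIndependent ℝ y := by
    have h1 : LinearIndependent ℝ fun j => e (f j) :=
      e.linearIndependent.comp (fun j => (f j : Fin N)) (Subtype.val_injective.comp f.injective)
    have hs : ∀ j, √(d (f j)) ≠ 0 := fun j =>
      (Real.sqrt_pos.2 (lt_of_le_of_ne (hd _) (f j).2.symm)).ne'
    exact h1.units_smul fun j => Units.mk0 _ (hs j)
  have hTinj : LinearMap.ker T.toLinearMap = ⊥ := by
    rw [LinearMap.ker_eq_bot']
    intro x hx
    have hx' : ∑ j, x j • y j = 0 := by
      rw [← hx]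
      simp [T, Module.Basis.constr_apply_fintype]
    ext j
    exact Fintype.linearIndependent_iff.1 hind _ hx' j
  obtain ⟨S, hS⟩ := LinearMap.exists_leftInverse_of_injective T.toLinearMap hTinj
  refine ⟨_, T, LinearMap.toContinuousLinearMap S, fun v => LinearMap.congr_fun hS v,
    fun L₁ L₂ => ?_⟩
  rw [hβe]
  simp only [hTs, y, map_smul, smul_eq_mul]
  have h2 : ∀ j, √(d (f j)) * L₁ (e (f j)) * (√(d (f j)) * L₂ (e (f j))) =
      d (f j) * (L₁ (e (f j)) * L₂ (e (f j))) := by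
    intro j
    nth_rw 3 [← Real.mul_self_sqrt (hd (f j))]
    ring
  simp_rw [h2]
  rw [f.sum_comp (fun i : {i // d i ≠ 0} => d i * (L₁ (e i) * L₂ (e i))),
    ← Finset.sum_subtype (Finset.univ.filter fun i => d i ≠ 0) (by simp)
      fun i => d i * (L₁ (e i) * L₂ (e i))]
  symm
  apply Finset.sum_filter_of_ne
  intro i _ hi h0
  exact hi (by rw [h0, zero_mul])

/-- The covariance of `x` may be singular. The factorization supplies functionals `t i` that are
orthonormal for it, and `A` is the sum of the projections of `w` on them. Any functional of `x`
differs from a combination of the `t i` by one of zero variance, which by Cauchy-Schwarz is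
uncorrelated with everything. -/
theorem exists_regression {n : ℕ}
    {β : StrongDual ℝ (F × EuclideanSpace ℝ (Fin n)) →L[ℝ]
      StrongDual ℝ (F × EuclideanSpace ℝ (Fin n)) →L[ℝ] ℝ} (hβ : IsCovForm β) :
    ∃ A : F →L[ℝ] EuclideanSpace ℝ (Fin n), ∀ (L₁ : StrongDual ℝ F)
      (L₂ : StrongDual ℝ (EuclideanSpace ℝ (Fin n))),
      β (L₁ ∘L .fst ℝ F (EuclideanSpace ℝ (Fin n)))
        (L₂ ∘L (.snd ℝ F (EuclideanSpace ℝ (Fin n)) - A ∘L .fst ℝ F _)) = 0 := by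
  let G := EuclideanSpace ℝ (Fin n)
  let ι : StrongDual ℝ F →L[ℝ] StrongDual ℝ (F × G) :=
    (ContinuousLinearMap.compL ℝ (F × G) F ℝ).flip (.fst ℝ F G)
  let κ : StrongDual ℝ G →L[ℝ] StrongDual ℝ (F × G) :=
    (ContinuousLinearMap.compL ℝ (F × G) G ℝ).flip (.snd ℝ F G)
  let βF : StrongDual ℝ F →L[ℝ] StrongDual ℝ F →L[ℝ] ℝ := β.bilinearComp ι ι
  have hβF : IsCovForm βF := ⟨fun L₁ L₂ => hβ.1 _ _, fun L => hβ.2 _⟩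
  obtain ⟨k, T, S, hST, hfac⟩ := hβF.exists_factorization
  let t : Fin k → StrongDual ℝ F := fun i => EuclideanSpace.proj i ∘L S
  let c : Fin k → G := fun i => WithLp.toLp 2 fun j => β (ι (t i)) (κ (EuclideanSpace.proj j))
  have hL : ∀ L : StrongDual ℝ G, L = ∑ j, L (EuclideanSpace.single j 1) •
      (EuclideanSpace.proj j : G →L[ℝ] ℝ) := by
    intro L
    apply ContinuousLinearMap.coe_injective
    refine (EuclideanSpace.basisFun (Fin n) ℝ).toBasis.ext fun j => ?_
    simp
  have hc : ∀ i (L : StrongDual ℝ G), β (ι (t i)) (κ L) = L (c i) := by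
    intro i L
    rw [hL L]
    simp [c]
    rfl
  let A : F →L[ℝ] G := ∑ i, (t i).smulRight (c i)
  have hA : ∀ i, A (T (EuclideanSpace.single i 1)) = c i := by
    intro i
    simp [A, t, hST]
  refine ⟨A, fun L₁ L₂ => ?_⟩
  let K : StrongDual ℝ (F × G) := L₂ ∘L (.snd ℝ F G - A ∘L .fst ℝ F G)
  have hK : K = κ L₂ - ι (L₂ ∘L A) := by
    ext <;> simp [K, κ, ι]
  have ht : ∀ i, β (ι (t i)) K = 0 := by
    intro i
    rw [hK, map_sub, hc]
    have : β (ι (t i)) (ι (L₂ ∘L A)) = βF (t i) (L₂ ∘L A) := rfl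
    rw [this, hfac]
    simp [t, hST, hA]
  let N : StrongDual ℝ F := L₁ - L₁ ∘L T ∘L S
  have hN : βF N N = 0 := by
    rw [hfac]
    simp [N, hST]
  have hNK : β (ι N) K = 0 := by
    have h := hβ.sq_le (ι N) K
    have h0 : β (ι N) (ι N) = 0 := hN
    rw [h0, zero_mul] at h
    exact pow_eq_zero_iff (two_ne_zero) |>.1 (le_antisymm h (sq_nonneg _))
  have hL₁ : L₁ = N + ∑ i, L₁ (T (EuclideanSpace.single i 1)) • t i := by
    have h1 : L₁ ∘L T ∘L S = ∑ i, L₁ (T (EuclideanSpace.single i 1)) • t i := by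
      ext x
      have h2 : S x = ∑ i, (S x) i • EuclideanSpace.single i (1 : ℝ) := by
        ext j; simp [Pi.single_apply]
      simp only [ContinuousLinearMap.comp_apply]
      rw [h2]
      simp [t, mul_comm]
    rw [← h1]
    simp [N]
  change β (ι L₁) K = 0
  rw [hL₁]
  simp [map_add, map_sum, hNK, ht]

end Factorization

/-! ### Gaussian measures with prescribed moments, standardization and regression -/

section GaussianMeasures

variable {E F : Type*} [NormedAddCommGroup E] [NormedSpace ℝ E] [FiniteDimensional ℝ E]
  [MeasurableSpace E] [BorelSpace E]
  [NormedAddCommGroup F] [NormedSpace ℝ F] [FiniteDimensional ℝ F]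
  [MeasurableSpace F] [BorelSpace F] {μ : Measure E}

theorem isCovForm_covarianceBilinDual (μ : Measure E) : IsCovForm (covarianceBilinDual μ) :=
  ⟨fun L₁ L₂ => covarianceBilinDual_comm L₁ L₂, fun L => covarianceBilinDual_self_nonneg L⟩

theorem memLp_id_map_affine [IsProbabilityMeasure μ] (hμ : MemLp id 2 μ) (T : E →L[ℝ] F) (c : F) :
    MemLp id 2 (μ.map fun x => T x + c) := by
  rw [memLp_map_measure_iff (by fun_prop) (by fun_prop)]
  have h : MemLp (fun x => T x) 2 μ := T.comp_memLp' hμ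
  exact h.add (memLp_const c)

theorem integral_id_map_affine [IsProbabilityMeasure μ] (hμ : MemLp id 2 μ) (T : E →L[ℝ] F)
    (c : F) : ∫ y, y ∂(μ.map fun x => T x + c) = T (∫ x, x ∂μ) + c := by
  have hInt : Integrable (fun x : E => x) μ := hμ.integrable (by norm_num)
  rw [integral_map (by fun_prop) (by fun_prop), integral_add (T.integrable_comp hInt)
    (integrable_const c), T.integral_comp_comm hInt]
  simp

theorem covarianceBilinDual_map_affine [IsProbabilityMeasure μ] (hμ : MemLp id 2 μ)
    (T : E →L[ℝ] F) (c : F) (L₁ L₂ : StrongDual ℝ F) :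
    covarianceBilinDual (μ.map fun x => T x + c) L₁ L₂ =
      covarianceBilinDual μ (L₁ ∘L T) (L₂ ∘L T) := by
  have hInt (L : StrongDual ℝ E) : Integrable L μ := L.integrable_comp (hμ.integrable (by norm_num))
  rw [covarianceBilinDual_eq_covariance (memLp_id_map_affine hμ T c),
    covarianceBilinDual_eq_covariance hμ, covariance_map_fun (by fun_prop) (by fun_prop)
    (by fun_prop)]
  simp only [map_add]
  exact (covariance_add_const_left (hInt (L₁ ∘L T)) _).trans
    (covariance_add_const_right (hInt (L₂ ∘L T)) _)

theorem isGaussian_map_affine [IsGaussian μ] (T : E →L[ℝ] F) (c : F) :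
    IsGaussian (μ.map fun x => T x + c) := by
  have h : (μ.map fun x => T x + c) = (μ.map T).map (· + c) := by
    rw [Measure.map_map (by fun_prop) (by fun_prop)]
    rfl
  rw [h]
  infer_instance

theorem covarianceBilinDual_stdGaussian {k : ℕ}
    (L₁ L₂ : StrongDual ℝ (EuclideanSpace ℝ (Fin k))) :
    covarianceBilinDual (stdGaussian _) L₁ L₂ =
      ∑ i, L₁ (EuclideanSpace.single i 1) * L₂ (EuclideanSpace.single i 1) := by
  obtain ⟨x, rfl⟩ := (InnerProductSpace.toDual ℝ _).surjective L₁
  obtain ⟨y, rfl⟩ := (InnerProductSpace.toDual ℝ _).surjective L₂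
  have h := covarianceBilin_eq_covarianceBilinDual (μ := stdGaussian (EuclideanSpace ℝ (Fin k))) x y
  rw [covarianceBilin_stdGaussian] at h
  refine h.symm.trans ?_
  simp [PiLp.inner_apply, mul_comm, innerSL_apply_apply ℝ]

theorem map_affine_stdGaussian_moments {k : ℕ} (T : EuclideanSpace ℝ (Fin k) →L[ℝ] E) (m : E) :
    IsGaussian ((stdGaussian _).map fun v => T v + m) ∧
      ∫ x, x ∂((stdGaussian _).map fun v => T v + m) = m ∧
      ∀ L₁ L₂, covarianceBilinDual ((stdGaussian _).map fun v => T v + m) L₁ L₂ =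
        ∑ i, L₁ (T (EuclideanSpace.single i 1)) * L₂ (T (EuclideanSpace.single i 1)) := by
  refine ⟨isGaussian_map_affine T m, ?_, fun L₁ L₂ => ?_⟩
  · rw [integral_id_map_affine IsGaussian.memLp_two_id, integral_id_stdGaussian]
    simp
  · rw [covarianceBilinDual_map_affine IsGaussian.memLp_two_id, covarianceBilinDual_stdGaussian]
    rfl

theorem exists_isGaussian_of_isCovForm (m : E)
    {β : StrongDual ℝ E →L[ℝ] StrongDual ℝ E →L[ℝ] ℝ} (hβ : IsCovForm β) :
    ∃ μ : Measure E, IsGaussian μ ∧ ∫ x, x ∂μ = m ∧ covarianceBilinDual μ = β := by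
  obtain ⟨k, T, S, -, hfac⟩ := hβ.exists_factorization
  obtain ⟨h1, h2, h3⟩ := map_affine_stdGaussian_moments T m
  refine ⟨_, h1, h2, ?_⟩
  ext L₁ L₂
  rw [h3, hfac]

/-- A Gaussian measure is an injective affine image of a standard Gaussian measure. -/
theorem exists_standardization (μ : Measure E) [IsGaussian μ] :
    ∃ (k : ℕ) (T : EuclideanSpace ℝ (Fin k) →L[ℝ] E) (S : E →L[ℝ] EuclideanSpace ℝ (Fin k))
      (m : E), (∀ v, S (T v) = v) ∧ μ = (stdGaussian _).map fun v => T v + m := by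
  obtain ⟨k, T, S, hST, hfac⟩ := (isCovForm_covarianceBilinDual μ).exists_factorization
  obtain ⟨h1, h2, h3⟩ := map_affine_stdGaussian_moments T (∫ x, x ∂μ)
  refine ⟨k, T, S, ∫ x, x ∂μ, hST, IsGaussian.ext_covarianceBilinDual h2.symm ?_⟩
  ext L₁ L₂
  rw [h3, hfac]

/-- The predictor and the residual are jointly Gaussian, so being uncorrelated makes them
independent. -/
theorem exists_indepFun_regression {n : ℕ} (π : Measure (F × EuclideanSpace ℝ (Fin n)))
    [IsGaussian π] :
    ∃ A : F →L[ℝ] EuclideanSpace ℝ (Fin n),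
      IndepFun (fun z : F × EuclideanSpace ℝ (Fin n) => z.1) (fun z => z.2 - A z.1) π := by
  obtain ⟨A, hA⟩ := exists_regression (isCovForm_covarianceBilinDual π)
  refine ⟨A, HasGaussianLaw.indepFun_of_covariance_strongDual ?_ fun L₁ L₂ => ?_⟩
  · exact (IsGaussian.hasGaussianLaw_id (μ := π)).map_fun
      ((ContinuousLinearMap.fst ℝ F (EuclideanSpace ℝ (Fin n))).prod
        (ContinuousLinearMap.snd ℝ F _ - A ∘L .fst ℝ F _))
  · rw [← hA L₁ L₂, covarianceBilinDual_eq_covariance IsGaussian.memLp_two_id]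
    rfl

end GaussianMeasures

/-! ### Tightness of the regression bounds for Gaussian laws -/

section GaussianAttains

variable {F : Type*} [NormedAddCommGroup F] [NormedSpace ℝ F] [FiniteDimensional ℝ F]
  [MeasurableSpace F] [BorelSpace F] {n : ℕ}

/-- If some linear functional of `w` is almost surely an affine function of `x`, the lower bounds
given by regression models are unbounded. -/
theorem iSup_score_eq_top {π : Measure (F × EuclideanSpace ℝ (Fin n))} [IsProbabilityMeasure π]
    (A : F →L[ℝ] EuclideanSpace ℝ (Fin n)) (m : EuclideanSpace ℝ (Fin n))
    {a : EuclideanSpace ℝ (Fin n)} (ha : a ≠ 0)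
    (h : ∀ᵐ z ∂π, inner ℝ a (z.2 - A z.1 - m) = 0) :
    ⨆ θ : RegressionModel F n, ENNReal.ofReal (∫ z, θ.score z ∂π) = ∞ := by
  refine ENNReal.eq_top_of_forall_nnreal_le fun r => ?_
  have ha' : ‖a‖ ^ 2 ≠ 0 := by simpa using ha
  -- Chosen so that `w ↦ w + t⟨a, w⟩a` has determinant `1 + t‖a‖² = exp r`. Slope and shift cancel
  -- the added term almost surely, so the residual is `w` and the score is the constant `r`.
  let t : ℝ := (Real.exp r - 1) / ‖a‖ ^ 2
  let f : Module.Dual ℝ (EuclideanSpace ℝ (Fin n)) := (innerSL ℝ a).toLinearMap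
  let τ := LinearMap.transvection f (t • a)
  have hdet : LinearMap.det τ = Real.exp r := by
    rw [LinearMap.transvection.det]
    simp [f, t, ha]
  have hτ : LinearMap.det τ ≠ 0 := by rw [hdet]; positivity
  let θ : RegressionModel F n :=
    { scale := (LinearMap.equivOfDetNeZero τ hτ).toContinuousLinearEquiv
      slope := (t • (innerSL ℝ a).smulRight a) ∘L A
      shift := t • (inner ℝ a m) • a }
  have hdet' : θ.scaleDet = Real.exp r := hdet
  have hres : ∀ᵐ z ∂π, θ.score z = r := by
    filter_upwards [h] with z hz
    have h1 : θ.residual z = z.2 := by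
      have h2 : θ.residual z = z.2 + inner ℝ a z.2 • (t • a) -
        (t • (inner ℝ a (A z.1) • a) + t • (inner ℝ a m) • a) := rfl
      have h3 : inner ℝ a z.2 = inner ℝ a (A z.1) + inner ℝ a m := by
        rw [inner_sub_right, inner_sub_right] at hz
        linarith
      rw [h2, h3]
      module
    rw [RegressionModel.score, h1, hdet']
    simp
  refine le_trans ?_ (le_iSup _ θ)
  rw [integral_congr_ae hres]
  simp

/-- For Gaussian laws the divergence from `π_x ⊗ N(0, 1)` is the supremum of the lower bounds
given by regression models. -/
theorem klDiv_eq_iSup_score (π : Measure (F × EuclideanSpace ℝ (Fin n))) [IsGaussian π] :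
    klDiv π (π.fst.prod (stdGaussian _)) =
      ⨆ θ : RegressionModel F n, ENNReal.ofReal (∫ z, θ.score z ∂π) := by
  have hπ : MemLp id 2 π := IsGaussian.memLp_two_id
  refine le_antisymm ?_ (iSup_le fun θ => θ.ofReal_integral_score_le_klDiv hπ)
  obtain ⟨A, hA⟩ := exists_indepFun_regression π
  let R : F × EuclideanSpace ℝ (Fin n) → EuclideanSpace ℝ (Fin n) := fun z => z.2 - A z.1
  have hRm : Measurable R := by fun_prop
  have : IsGaussian (π.map R) := by
    have := isGaussian_map_affine (μ := π)
      (ContinuousLinearMap.snd ℝ F (EuclideanSpace ℝ (Fin n)) - A ∘L .fst ℝ F _) 0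
    simpa [R] using this
  obtain ⟨k, T, S, m, hST, hR⟩ := exists_standardization (π.map R)
  have hinj : Function.Injective T := Function.LeftInverse.injective hST
  -- `k` is the rank of the residual covariance. At full rank `T` is invertible and whitens the
  -- residual, which attains the bound; otherwise a vector orthogonal to the range of `T` gives a
  -- direction in which the residual is constant.
  by_cases hk : k = n
  · subst hk
    let P : EuclideanSpace ℝ (Fin k) ≃L[ℝ] EuclideanSpace ℝ (Fin k) :=
      (LinearEquiv.ofInjectiveEndo T.toLinearMap hinj).toContinuousLinearEquiv
    have hP : ∀ v, P v = T v := fun v => rfl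
    let θ : RegressionModel F k :=
      { scale := P.symm
        slope := (P.symm : EuclideanSpace ℝ (Fin k) →L[ℝ] EuclideanSpace ℝ (Fin k)) ∘L A
        shift := P.symm m }
    have hres : θ.residual = (fun v => P.symm (v - m)) ∘ R := by
      ext1 z
      simp [RegressionModel.residual, θ, R, sub_sub]
    have hlaw : π.map (fun z => (z.1, θ.residual z)) = π.fst.prod (stdGaussian _) := by
      have hind : IndepFun (fun z : F × EuclideanSpace ℝ (Fin k) => z.1) θ.residual π := by
        rw [hres]
        exact hA.comp (φ := id) measurable_id (by fun_prop)
      rw [(indepFun_iff_map_prod_eq_prod_map_map (by fun_prop) (by fun_prop)).1 hind]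
      have h2 : π.map θ.residual = stdGaussian _ := by
        rw [hres, ← Measure.map_map (by fun_prop) hRm, hR, Measure.map_map (by fun_prop)
          (by fun_prop)]
        have : (fun v => P.symm (v - m)) ∘ (fun v => T v + m) = id := by
          ext1 v
          simp [← hP]
        rw [this, Measure.map_id]
      rw [h2]
      rfl
    rw [θ.klDiv_eq_ofReal_integral_score hπ hlaw]
    exact le_iSup (fun θ : RegressionModel F k => ENNReal.ofReal (∫ z, θ.score z ∂π)) θ
  · have hrange : LinearMap.range T.toLinearMap ≠ ⊤ := by
      intro htop
      apply hk
      have h := (LinearEquiv.ofBijective T.toLinearMap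
        ⟨hinj, LinearMap.range_eq_top.1 htop⟩).finrank_eq
      simpa using h
    obtain ⟨a, ha, ha0⟩ := Submodule.exists_mem_ne_zero_of_ne_bot
      (mt Submodule.orthogonal_eq_bot_iff.1 hrange)
    rw [iSup_score_eq_top A m ha0]
    · exact le_top
    · have h : ∀ᵐ y ∂(π.map R), inner ℝ a (y - m) = 0 := by
        rw [hR, ae_map_iff (by fun_prop) (measurableSet_eq_fun (by fun_prop) (by fun_prop))]
        refine Filter.Eventually.of_forall fun v => ?_
        rw [add_sub_cancel_right]
        exact (Submodule.mem_orthogonal' _ _).1 ha _ ⟨v, rfl⟩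
      exact ae_of_ae_map hRm.aemeasurable h

end GaussianAttains

/-! ### Divergences bounded in terms of first and second moments -/

section Moments

variable {E F : Type*} [NormedAddCommGroup E] [NormedSpace ℝ E] [FiniteDimensional ℝ E]
  [MeasurableSpace E] [BorelSpace E]
  [NormedAddCommGroup F] [NormedSpace ℝ F] [FiniteDimensional ℝ F]
  [MeasurableSpace F] [BorelSpace F] {n : ℕ} {μ : Measure E}

/-- The expectation of `‖T x + c‖²` for a random vector `x` with mean `m` and covariance `β`. -/
def sqMoment (T : E →L[ℝ] EuclideanSpace ℝ (Fin n)) (c : EuclideanSpace ℝ (Fin n)) (m : E)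
    (β : StrongDual ℝ E →L[ℝ] StrongDual ℝ E →L[ℝ] ℝ) : ℝ :=
  ∑ i, (β (EuclideanSpace.proj i ∘L T) (EuclideanSpace.proj i ∘L T) + (T m + c) i ^ 2)

theorem integrable_norm_sq_affine [IsProbabilityMeasure μ] (hμ : MemLp id 2 μ)
    (T : E →L[ℝ] EuclideanSpace ℝ (Fin n)) (c : EuclideanSpace ℝ (Fin n)) :
    Integrable (fun x => ‖T x + c‖ ^ 2) μ := by
  have h : MemLp (fun x => T x) 2 μ := T.comp_memLp' hμ
  have h' : MemLp (fun x => T x + c) 2 μ := h.add (memLp_const c)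
  exact h'.integrable_norm_pow (by norm_num)

theorem integral_norm_sq_affine [IsProbabilityMeasure μ] (hμ : MemLp id 2 μ)
    (T : E →L[ℝ] EuclideanSpace ℝ (Fin n)) (c : EuclideanSpace ℝ (Fin n)) :
    ∫ x, ‖T x + c‖ ^ 2 ∂μ = sqMoment T c (∫ x, x ∂μ) (covarianceBilinDual μ) := by
  have hL : ∀ i, MemLp (fun x => (T x + c) i) 2 μ := by
    intro i
    have h : MemLp (fun x => (EuclideanSpace.proj i ∘L T) x) 2 μ :=
      (EuclideanSpace.proj i ∘L T).comp_memLp' hμ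
    exact h.add (memLp_const (c i))
  simp_rw [EuclideanSpace.real_norm_sq_eq]
  rw [integral_finsetSum _ fun i _ => (hL i).integrable_sq, sqMoment]
  refine Finset.sum_congr rfl fun i _ => ?_
  have hInt : Integrable (EuclideanSpace.proj i ∘L T) μ :=
    (EuclideanSpace.proj i ∘L T).integrable_comp (hμ.integrable (by norm_num))
  have h1 : ∫ x, (T x + c) i ∂μ = (T (∫ x, x ∂μ) + c) i := by
    have h2 := (EuclideanSpace.proj i ∘L T).integral_comp_comm (μ := μ) (φ := fun x => x)
      (hμ.integrable (by norm_num))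
    have h3 : ∫ x, (T x + c) i ∂μ = ∫ x, ((EuclideanSpace.proj i ∘L T) x + c i) ∂μ := rfl
    rw [h3, integral_add hInt (integrable_const _), h2]
    simp
  have h4 := variance_eq_sub (hL i)
  have h5 : Var[fun x => (T x + c) i; μ] = Var[EuclideanSpace.proj i ∘L T; μ] :=
    variance_add_const hInt.1 (c i)
  rw [covarianceBilinDual_self_eq_variance hμ, ← h1, ← h5, h4]
  simp

theorem continuous_sqMoment (T : E →L[ℝ] EuclideanSpace ℝ (Fin n))
    (c : EuclideanSpace ℝ (Fin n)) (m : E) : Continuous (sqMoment T c m) := by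
  unfold sqMoment
  fun_prop

/-- The divergence of the law of `(X x, M x + c)` from the product of the law of `X x` and the
standard Gaussian measure. -/
def affineDiv (μ : Measure E) (X : E →L[ℝ] F) (M : E →L[ℝ] EuclideanSpace ℝ (Fin n))
    (c : EuclideanSpace ℝ (Fin n)) : ℝ≥0∞ :=
  klDiv (μ.map fun x => (X x, M x + c)) ((μ.map X).prod (stdGaussian _))

/-- The largest lower bound on `affineDiv μ X M c` given by regression models, for a measure `μ`
with mean `m` and covariance `β`. -/
def affineDivBound (X : E →L[ℝ] F) (M : E →L[ℝ] EuclideanSpace ℝ (Fin n))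
    (c : EuclideanSpace ℝ (Fin n)) (m : E) (β : StrongDual ℝ E →L[ℝ] StrongDual ℝ E →L[ℝ] ℝ) :
    ℝ≥0∞ :=
  ⨆ θ : RegressionModel F n, ENNReal.ofReal (Real.log |θ.scaleDet| -
    (1 / 2) * sqMoment ((θ.scale : EuclideanSpace ℝ (Fin n) →L[ℝ] EuclideanSpace ℝ (Fin n)) ∘L M -
      θ.slope ∘L X) (θ.scale c - θ.shift) m β + (1 / 2) * sqMoment M c m β)

/-- For fixed `θ` the argument of `ENNReal.ofReal` is continuous in `β`, and suprema preserve lower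
semicontinuity. -/
theorem lowerSemicontinuous_affineDivBound (X : E →L[ℝ] F)
    (M : E →L[ℝ] EuclideanSpace ℝ (Fin n)) (c : EuclideanSpace ℝ (Fin n)) (m : E) :
    LowerSemicontinuous (affineDivBound X M c m) := by
  refine lowerSemicontinuous_iSup fun θ => ?_
  apply Continuous.lowerSemicontinuous
  refine ENNReal.continuous_ofReal.comp ?_
  exact (continuous_const.sub ((continuous_sqMoment _ _ _).const_mul _)).add
    ((continuous_sqMoment _ _ _).const_mul _)

theorem map_prod_affine_eq (μ : Measure E) (X : E →L[ℝ] F)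
    (M : E →L[ℝ] EuclideanSpace ℝ (Fin n)) (c : EuclideanSpace ℝ (Fin n)) :
    (μ.map fun x => (X x, M x + c)) = μ.map fun x => X.prod M x + (0, c) := by
  simp

theorem fst_map_prod_affine (μ : Measure E) (X : E →L[ℝ] F)
    (M : E →L[ℝ] EuclideanSpace ℝ (Fin n)) (c : EuclideanSpace ℝ (Fin n)) :
    (μ.map fun x => (X x, M x + c)).fst = μ.map X :=
  Measure.fst_map_prodMk (by fun_prop)

/-- The score composed with an affine map is quadratic, so its expectation involves only two moments
of `μ`. -/
theorem iSup_integral_score_map [IsProbabilityMeasure μ] (hμ : MemLp id 2 μ) (X : E →L[ℝ] F)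
    (M : E →L[ℝ] EuclideanSpace ℝ (Fin n)) (c : EuclideanSpace ℝ (Fin n)) :
    ⨆ θ : RegressionModel F n, ENNReal.ofReal (∫ z, θ.score z ∂(μ.map fun x => (X x, M x + c))) =
      affineDivBound X M c (∫ x, x ∂μ) (covarianceBilinDual μ) := by
  refine iSup_congr fun θ => congrArg ENNReal.ofReal ?_
  rw [integral_map (by fun_prop) (by fun_prop), ← integral_norm_sq_affine hμ,
    ← integral_norm_sq_affine hμ]
  have h1 := integrable_norm_sq_affine hμ
    ((θ.scale : EuclideanSpace ℝ (Fin n) →L[ℝ] EuclideanSpace ℝ (Fin n)) ∘L M - θ.slope ∘L X)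
      (θ.scale c - θ.shift)
  have h2 := integrable_norm_sq_affine hμ M c
  have h3 : ∀ x, θ.residual (X x, M x + c) =
      ((θ.scale : EuclideanSpace ℝ (Fin n) →L[ℝ] EuclideanSpace ℝ (Fin n)) ∘L M -
        θ.slope ∘L X) x + (θ.scale c - θ.shift) := by
    intro x
    simp [RegressionModel.residual]
    abel
  simp_rw [RegressionModel.score, h3]
  have h4 := h1.const_mul (1 / 2)
  have h5 := h2.const_mul (1 / 2)
  have h6 := (integrable_const (μ := μ) (Real.log |θ.scaleDet|)).sub h4
  refine (integral_add h6 h5).trans ?_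
  rw [integral_const_mul]
  congr 1
  refine (integral_sub (integrable_const _) h4).trans ?_
  rw [integral_const_mul]
  simp

theorem affineDivBound_le [IsProbabilityMeasure μ] (hμ : MemLp id 2 μ) (X : E →L[ℝ] F)
    (M : E →L[ℝ] EuclideanSpace ℝ (Fin n)) (c : EuclideanSpace ℝ (Fin n)) :
    affineDivBound X M c (∫ x, x ∂μ) (covarianceBilinDual μ) ≤ affineDiv μ X M c := by
  rw [← iSup_integral_score_map hμ, affineDiv, ← fst_map_prod_affine μ X M c]
  have h := memLp_id_map_affine hμ (X.prod M) (0, c)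
  rw [← map_prod_affine_eq] at h
  have : IsProbabilityMeasure (μ.map fun x => (X x, M x + c)) :=
    Measure.isProbabilityMeasure_map (by fun_prop)
  exact iSup_le fun θ => θ.ofReal_integral_score_le_klDiv h

theorem affineDiv_eq_bound [IsGaussian μ] (X : E →L[ℝ] F)
    (M : E →L[ℝ] EuclideanSpace ℝ (Fin n)) (c : EuclideanSpace ℝ (Fin n)) :
    affineDiv μ X M c = affineDivBound X M c (∫ x, x ∂μ) (covarianceBilinDual μ) := by
  rw [← iSup_integral_score_map IsGaussian.memLp_two_id, affineDiv, ← fst_map_prod_affine μ X M c]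
  have : IsGaussian (μ.map fun x => (X x, M x + c)) := by
    rw [map_prod_affine_eq]
    exact isGaussian_map_affine _ _
  exact klDiv_eq_iSup_score _

/-- Among laws with given moments, the Gaussian one has the smallest divergence. -/
theorem affineDiv_le_of_moments_eq {ν : Measure E} [IsProbabilityMeasure μ] (hμ : MemLp id 2 μ)
    [IsGaussian ν] (hm : ∫ x, x ∂ν = ∫ x, x ∂μ)
    (hc : covarianceBilinDual ν = covarianceBilinDual μ) (X : E →L[ℝ] F)
    (M : E →L[ℝ] EuclideanSpace ℝ (Fin n)) (c : EuclideanSpace ℝ (Fin n)) :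
    affineDiv ν X M c ≤ affineDiv μ X M c := by
  rw [affineDiv_eq_bound, hm, hc]
  exact affineDivBound_le hμ X M c

end Moments

/-! ### The covariances of the feasible laws form a compact set -/

section CovSet

variable {E E₁ E₂ : Type*} [NormedAddCommGroup E] [NormedSpace ℝ E]
  [NormedAddCommGroup E₁] [NormedSpace ℝ E₁] [NormedAddCommGroup E₂] [NormedSpace ℝ E₂]
  (p₁ : E →L[ℝ] E₁) (p₂ : E →L[ℝ] E₂)

/-- The covariance forms on `E` with the same restrictions to two quotients of `E` as `α`. -/
def covSet (α : StrongDual ℝ E →L[ℝ] StrongDual ℝ E →L[ℝ] ℝ) :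
    Set (StrongDual ℝ E →L[ℝ] StrongDual ℝ E →L[ℝ] ℝ) :=
  {β | IsCovForm β ∧ (∀ L₁ L₂, β (L₁ ∘L p₁) (L₂ ∘L p₁) = α (L₁ ∘L p₁) (L₂ ∘L p₁)) ∧
    ∀ L₁ L₂, β (L₁ ∘L p₂) (L₂ ∘L p₂) = α (L₁ ∘L p₂) (L₂ ∘L p₂)}

theorem isClosed_covSet
    (α : StrongDual ℝ E →L[ℝ] StrongDual ℝ E →L[ℝ] ℝ) :
    IsClosed (covSet p₁ p₂ α) := by
  have hev : ∀ L₁ L₂, Continuous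
      fun β : StrongDual ℝ E →L[ℝ] StrongDual ℝ E →L[ℝ] ℝ =>
        β L₁ L₂ := fun L₁ L₂ => by fun_prop
  simp only [covSet, IsCovForm, Set.ofPred_and, Set.ofPred_forall]
  refine ((isClosed_iInter fun L₁ => isClosed_iInter fun L₂ => isClosed_eq (hev _ _) (hev _ _)).inter
    (isClosed_iInter fun L => isClosed_le continuous_const (hev _ _))).inter
    ((isClosed_iInter fun L₁ => isClosed_iInter fun L₂ => isClosed_eq (hev _ _) continuous_const).inter
    (isClosed_iInter fun L₁ => isClosed_iInter fun L₂ => isClosed_eq (hev _ _) continuous_const))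

theorem IsCovForm.apply_add_le {β : StrongDual ℝ E →L[ℝ] StrongDual ℝ E →L[ℝ] ℝ} (hβ : IsCovForm β)
    (L₁ L₂ : StrongDual ℝ E) : β (L₁ + L₂) (L₁ + L₂) ≤ 2 * (β L₁ L₁ + β L₂ L₂) := by
  have h := hβ.2 (L₁ - L₂)
  simp only [map_add, map_sub, add_apply, sub_apply] at h ⊢
  linarith

theorem IsCovForm.norm_le {β : StrongDual ℝ E →L[ℝ] StrongDual ℝ E →L[ℝ] ℝ} (hβ : IsCovForm β) {C : ℝ} (hC : 0 ≤ C)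
    (h : ∀ L, β L L ≤ C * ‖L‖ ^ 2) : ‖β‖ ≤ C := by
  refine β.opNorm_le_bound₂ hC fun L₁ L₂ => ?_
  refine abs_le_of_sq_le_sq ?_ (by positivity)
  calc β L₁ L₂ ^ 2 ≤ β L₁ L₁ * β L₂ L₂ := hβ.sq_le L₁ L₂
    _ ≤ (C * ‖L₁‖ ^ 2) * (C * ‖L₂‖ ^ 2) :=
      mul_le_mul (h L₁) (h L₂) (hβ.2 _) (by positivity)
    _ = (C * ‖L₁‖ * ‖L₂‖) ^ 2 := by ring

/-- By `hi` every functional is a sum of one factoring through `p₁` and one factoring through `p₂`.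
On each summand the variance is prescribed by `α`, and positivity bounds the variance of the sum by
twice the sum of the variances. -/
theorem isCompact_covSet [FiniteDimensional ℝ E] {i₁ : E₁ →L[ℝ] E} {i₂ : E₂ →L[ℝ] E}
    (hi : ∀ z, i₁ (p₁ z) + i₂ (p₂ z) = z)
    (α : StrongDual ℝ E →L[ℝ] StrongDual ℝ E →L[ℝ] ℝ) :
    IsCompact (covSet p₁ p₂ α) := by
  have : ProperSpace
    (StrongDual ℝ E →L[ℝ] StrongDual ℝ E →L[ℝ] ℝ) :=
    FiniteDimensional.proper ℝ _
  refine Metric.isCompact_of_isClosed_isBounded (isClosed_covSet p₁ p₂ α) ?_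
  let P₁ : E →L[ℝ] E := i₁ ∘L p₁
  let P₂ : E →L[ℝ] E := i₂ ∘L p₂
  refine isBounded_iff_forall_norm_le.2 ⟨2 * ‖α‖ * (‖P₁‖ ^ 2 + ‖P₂‖ ^ 2), ?_⟩
  rintro β ⟨hβ, h₁, h₂⟩
  refine hβ.norm_le (by positivity) fun L => ?_
  have hL : L = L ∘L P₁ + L ∘L P₂ := by
    ext1 z
    conv_lhs => rw [← hi z, map_add]
    rfl
  have hα (P : E →L[ℝ] E) :
      α (L ∘L P) (L ∘L P) ≤ ‖α‖ * (‖L‖ * ‖P‖) * (‖L‖ * ‖P‖) :=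
    (le_abs_self _).trans ((α.le_opNorm₂ _ _).trans (by gcongr <;> exact L.opNorm_comp_le P))
  have e₁ : β (L ∘L P₁) (L ∘L P₁) = α (L ∘L P₁) (L ∘L P₁) := h₁ (L ∘L i₁) (L ∘L i₁)
  have e₂ : β (L ∘L P₂) (L ∘L P₂) = α (L ∘L P₂) (L ∘L P₂) := h₂ (L ∘L i₂) (L ∘L i₂)
  calc β L L ≤ 2 * (β (L ∘L P₁) (L ∘L P₁) + β (L ∘L P₂) (L ∘L P₂)) := by
        conv_lhs => rw [hL]
        exact hβ.apply_add_le _ _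
    _ ≤ 2 * (‖α‖ * (‖L‖ * ‖P₁‖) * (‖L‖ * ‖P₁‖) + ‖α‖ * (‖L‖ * ‖P₂‖) * (‖L‖ * ‖P₂‖)) := by
        rw [e₁, e₂]
        gcongr
        · exact hα P₁
        · exact hα P₂
    _ = 2 * ‖α‖ * (‖P₁‖ ^ 2 + ‖P₂‖ ^ 2) * ‖L‖ ^ 2 := by ring

end CovSet

/-! ### Moments of feasible laws and Gaussian laws with feasible covariance -/

section Feasible

variable {d₁ d₂ dY : ℕ}

/-- The projection `(x₁, x₂, y) ↦ (x₁, y)`. -/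
def proj₁ : Triple d₁ d₂ dY →L[ℝ] EuclideanSpace ℝ (Fin d₁) × EuclideanSpace ℝ (Fin dY) :=
  (ContinuousLinearMap.fst ℝ _ _).prod
    ((ContinuousLinearMap.snd ℝ _ _) ∘L (ContinuousLinearMap.snd ℝ _ _))

/-- The projection `(x₁, x₂, y) ↦ (x₂, y)`. -/
def proj₂ : Triple d₁ d₂ dY →L[ℝ] EuclideanSpace ℝ (Fin d₂) × EuclideanSpace ℝ (Fin dY) :=
  ContinuousLinearMap.snd ℝ _ _

/-- The embedding `(x₁, y) ↦ (x₁, 0, y)`. -/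
def incl₁ : EuclideanSpace ℝ (Fin d₁) × EuclideanSpace ℝ (Fin dY) →L[ℝ] Triple d₁ d₂ dY :=
  (ContinuousLinearMap.fst ℝ _ _).prod
    ((0 : _ →L[ℝ] EuclideanSpace ℝ (Fin d₂)).prod (ContinuousLinearMap.snd ℝ _ _))

/-- The map `(x₂, y) ↦ (0, x₂, 0)`. -/
def incl₂ : EuclideanSpace ℝ (Fin d₂) × EuclideanSpace ℝ (Fin dY) →L[ℝ] Triple d₁ d₂ dY :=
  (0 : _ →L[ℝ] EuclideanSpace ℝ (Fin d₁)).prod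
    ((ContinuousLinearMap.fst ℝ _ _).prod (0 : _ →L[ℝ] EuclideanSpace ℝ (Fin dY)))

/-- The shared coordinate `y` is carried by `incl₁` alone, so that it is not counted twice. This
splitting gives moments, means and compactness from the pairwise marginals. -/
theorem incl₁_proj₁_add_incl₂_proj₂ (z : Triple d₁ d₂ dY) :
    incl₁ (proj₁ z) + incl₂ (proj₂ z) = z := by
  ext <;> simp [incl₁, incl₂, proj₁, proj₂]

theorem marginal₁_eq (q : Law d₁ d₂ dY) :
    marginal₁ q = (q : Measure (Triple d₁ d₂ dY)).map proj₁ := rfl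

theorem marginal₂_eq (q : Law d₁ d₂ dY) :
    marginal₂ q = (q : Measure (Triple d₁ d₂ dY)).map proj₂ := rfl

theorem covarianceBilinDual_map {E F : Type*} [NormedAddCommGroup E] [NormedSpace ℝ E]
    [FiniteDimensional ℝ E] [MeasurableSpace E] [BorelSpace E]
    [NormedAddCommGroup F] [NormedSpace ℝ F] [FiniteDimensional ℝ F]
    [MeasurableSpace F] [BorelSpace F] {μ : Measure E} [IsProbabilityMeasure μ]
    (hμ : MemLp id 2 μ) (T : E →L[ℝ] F) (L₁ L₂ : StrongDual ℝ F) :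
    covarianceBilinDual (μ.map T) L₁ L₂ = covarianceBilinDual μ (L₁ ∘L T) (L₂ ∘L T) := by
  simpa using covarianceBilinDual_map_affine hμ T 0 L₁ L₂

theorem memLp_proj {q : Law d₁ d₂ dY} (hq : q ∈ pairwiseGaussian d₁ d₂ dY) :
    MemLp proj₁ 2 (q : Measure (Triple d₁ d₂ dY)) ∧
      MemLp proj₂ 2 (q : Measure (Triple d₁ d₂ dY)) := by
  obtain ⟨h₁, h₂⟩ := hq
  rw [marginal₁_eq] at h₁
  rw [marginal₂_eq] at h₂
  have m₁ := h₁.memLp_two_id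
  have m₂ := h₂.memLp_two_id
  rw [memLp_map_measure_iff (by fun_prop) (by fun_prop)] at m₁ m₂
  exact ⟨m₁, m₂⟩

theorem hasFiniteMoments_of_mem {q : Law d₁ d₂ dY} (hq : q ∈ pairwiseGaussian d₁ d₂ dY) :
    HasFiniteMoments q := by
  obtain ⟨m₁, m₂⟩ := memLp_proj hq
  have h₁ : MemLp (fun z => incl₁ (d₂ := d₂) (proj₁ z)) 2 (q : Measure (Triple d₁ d₂ dY)) :=
    (incl₁ (d₂ := d₂)).comp_memLp' m₁
  have h₂ : MemLp (fun z => incl₂ (d₁ := d₁) (proj₂ z)) 2 (q : Measure (Triple d₁ d₂ dY)) :=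
    (incl₂ (d₁ := d₁)).comp_memLp' m₂
  have h := h₁.add h₂
  rw [HasFiniteMoments]
  convert h using 1
  ext1 z
  exact (incl₁_proj₁_add_incl₂_proj₂ z).symm

theorem integral_eq_of_mem {q : Law d₁ d₂ dY} (hq : q ∈ pairwiseGaussian d₁ d₂ dY) :
    ∫ z, z ∂(q : Measure (Triple d₁ d₂ dY)) =
      incl₁ (∫ w, w ∂(marginal₁ q)) + incl₂ (∫ w, w ∂(marginal₂ q)) := by
  obtain ⟨m₁, m₂⟩ := memLp_proj hq
  have i₁ := m₁.integrable (by norm_num)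
  have i₂ := m₂.integrable (by norm_num)
  rw [marginal₁_eq, marginal₂_eq, integral_map (by fun_prop) (by fun_prop),
    integral_map (by fun_prop) (by fun_prop), ← (incl₁ (d₂ := d₂)).integral_comp_comm i₁,
    ← (incl₂ (d₁ := d₁)).integral_comp_comm i₂, ← integral_add ((incl₁ (d₂ := d₂)).integrable_comp i₁)
    ((incl₂ (d₁ := d₁)).integrable_comp i₂)]
  simp_rw [incl₁_proj₁_add_incl₂_proj₂]

theorem covarianceBilinDual_mem_covSet {p q : Law d₁ d₂ dY}
    (hp : p ∈ pairwiseGaussian d₁ d₂ dY) (hq : q ∈ feasible p) :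
    covarianceBilinDual (q : Measure (Triple d₁ d₂ dY)) ∈
      covSet proj₁ proj₂ (covarianceBilinDual (p : Measure (Triple d₁ d₂ dY))) := by
  have mp := hasFiniteMoments_of_mem hp
  have mq := hasFiniteMoments_of_mem hq.1
  refine ⟨isCovForm_covarianceBilinDual _, fun L₁ L₂ => ?_, fun L₁ L₂ => ?_⟩
  · rw [← covarianceBilinDual_map mp, ← covarianceBilinDual_map mq, ← marginal₁_eq, ← marginal₁_eq,
      hq.2.1]
  · rw [← covarianceBilinDual_map mp, ← covarianceBilinDual_map mq, ← marginal₂_eq, ← marginal₂_eq,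
      hq.2.2]

theorem map_eq_of_moments_eq {E F : Type*} [NormedAddCommGroup E] [NormedSpace ℝ E]
    [FiniteDimensional ℝ E] [MeasurableSpace E] [BorelSpace E]
    [NormedAddCommGroup F] [NormedSpace ℝ F] [FiniteDimensional ℝ F]
    [MeasurableSpace F] [BorelSpace F] {μ ν : Measure E} [IsProbabilityMeasure μ]
    (hμ : MemLp id 2 μ) [IsGaussian ν] (T : E →L[ℝ] F) [IsGaussian (μ.map T)]
    (hm : ∫ x, x ∂ν = ∫ x, x ∂μ)
    (hc : ∀ L₁ L₂, covarianceBilinDual ν (L₁ ∘L T) (L₂ ∘L T) =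
      covarianceBilinDual μ (L₁ ∘L T) (L₂ ∘L T)) : ν.map T = μ.map T := by
  have hν : MemLp id 2 ν := IsGaussian.memLp_two_id
  refine IsGaussian.ext_covarianceBilinDual ?_ ?_
  · have h1 := integral_id_map_affine hμ T 0
    have h2 := integral_id_map_affine hν T 0
    simp only [add_zero] at h1 h2
    change ∫ y, y ∂(ν.map T) = ∫ y, y ∂(μ.map T)
    rw [h1, h2, hm]
  · ext L₁ L₂
    rw [covarianceBilinDual_map hμ, covarianceBilinDual_map hν, hc]

/-- Take the Gaussian law with the mean of `p` and covariance `β`: its pairwise marginals and those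
of `p` are Gaussian with equal moments, hence equal. -/
theorem exists_gaussian_of_mem_covSet {p : Law d₁ d₂ dY} (hp : p ∈ pairwiseGaussian d₁ d₂ dY)
    {β : StrongDual ℝ (Triple d₁ d₂ dY) →L[ℝ] StrongDual ℝ (Triple d₁ d₂ dY) →L[ℝ] ℝ}
    (hβ : β ∈ covSet proj₁ proj₂ (covarianceBilinDual (p : Measure (Triple d₁ d₂ dY)))) :
    ∃ q ∈ feasible p, IsJointlyGaussian q ∧
      ∫ z, z ∂(q : Measure (Triple d₁ d₂ dY)) = ∫ z, z ∂(p : Measure (Triple d₁ d₂ dY)) ∧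
      covarianceBilinDual (q : Measure (Triple d₁ d₂ dY)) = β := by
  obtain ⟨hcov, h₁, h₂⟩ := hβ
  obtain ⟨μ, hμ, hm, hc⟩ := exists_isGaussian_of_isCovForm
    (∫ z, z ∂(p : Measure (Triple d₁ d₂ dY))) hcov
  have mp := hasFiniteMoments_of_mem hp
  let q : Law d₁ d₂ dY := ⟨μ, inferInstance⟩
  have : IsGaussian ((p : Measure (Triple d₁ d₂ dY)).map proj₁) := hp.1
  have : IsGaussian ((p : Measure (Triple d₁ d₂ dY)).map proj₂) := hp.2
  have e₁ : marginal₁ q = marginal₁ p :=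
    map_eq_of_moments_eq (ν := μ) mp proj₁ hm fun L₁ L₂ => by rw [hc, h₁]
  have e₂ : marginal₂ q = marginal₂ p :=
    map_eq_of_moments_eq (ν := μ) mp proj₂ hm fun L₁ L₂ => by rw [hc, h₂]
  refine ⟨q, ⟨⟨?_, ?_⟩, e₁, e₂⟩, hμ, hm, hc⟩
  · rw [e₁]
    exact hp.1
  · rw [e₂]
    exact hp.2

/-- The divergence of an affine image from a standard Gaussian is minimized over the feasible set
by a Gaussian law. -/
theorem exists_isMinOn_affineDiv {F : Type*} [NormedAddCommGroup F] [NormedSpace ℝ F]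
    [FiniteDimensional ℝ F] [MeasurableSpace F] [BorelSpace F] {n : ℕ} {p : Law d₁ d₂ dY}
    (hp : p ∈ pairwiseGaussian d₁ d₂ dY) (X : Triple d₁ d₂ dY →L[ℝ] F)
    (M : Triple d₁ d₂ dY →L[ℝ] EuclideanSpace ℝ (Fin n)) (c : EuclideanSpace ℝ (Fin n)) :
    ∃ q ∈ feasible p, IsJointlyGaussian q ∧
      IsMinOn (fun q : Law d₁ d₂ dY => affineDiv (q : Measure (Triple d₁ d₂ dY)) X M c)
        (feasible p) q := by
  obtain ⟨β, hβ, hmin⟩ := ((lowerSemicontinuous_affineDivBound X M c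
      (∫ z, z ∂(p : Measure (Triple d₁ d₂ dY)))).lowerSemicontinuousOn _).exists_isMinOn
    ⟨_, covarianceBilinDual_mem_covSet hp (q := p) ⟨hp, rfl, rfl⟩⟩ (isCompact_covSet _ _ incl₁_proj₁_add_incl₂_proj₂ _)
  obtain ⟨q, hq, hG, hm, hc⟩ := exists_gaussian_of_mem_covSet hp hβ
  refine ⟨q, hq, hG, fun q' hq' => ?_⟩
  have : IsGaussian (q : Measure (Triple d₁ d₂ dY)) := hG
  have hm' : ∫ z, z ∂(q' : Measure (Triple d₁ d₂ dY)) =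
      ∫ z, z ∂(p : Measure (Triple d₁ d₂ dY)) := by
    rw [integral_eq_of_mem hq'.1, integral_eq_of_mem hp, hq'.2.1, hq'.2.2]
  -- The moment bound is an equality at the Gaussian `q` and only an inequality at the arbitrary
  -- competitor `q'`.
  calc affineDiv (q : Measure (Triple d₁ d₂ dY)) X M c = affineDivBound X M c _ β := by
        rw [affineDiv_eq_bound, hm, hc]
    _ ≤ affineDivBound X M c _ _ := hmin (covarianceBilinDual_mem_covSet hp hq')
    _ ≤ affineDiv (q' : Measure (Triple d₁ d₂ dY)) X M c := by
        rw [← hm']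
        exact affineDivBound_le (hasFiniteMoments_of_mem hq'.1) X M c

end Feasible

/-! ### Mutual informations as divergences from a standard Gaussian -/

section MutualInfo

theorem indepFun_comp_of_indepFun_map {Ω Ω' A B : Type*} [MeasurableSpace Ω] [MeasurableSpace Ω']
    [MeasurableSpace A] [MeasurableSpace B] {P : Measure Ω} [IsProbabilityMeasure P] {g : Ω → Ω'}
    {U : Ω' → A} {V : Ω' → B} (hg : Measurable g) (hU : Measurable U) (hV : Measurable V)
    (h : IndepFun U V (P.map g)) : IndepFun (fun ω => U (g ω)) (fun ω => V (g ω)) P := by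
  have : IsProbabilityMeasure (P.map g) := Measure.isProbabilityMeasure_map hg.aemeasurable
  rw [indepFun_iff_map_prod_eq_prod_map_map hU.aemeasurable hV.aemeasurable,
    Measure.map_map (by fun_prop) hg, Measure.map_map hU hg, Measure.map_map hV hg] at h
  exact (indepFun_iff_map_prod_eq_prod_map_map (by fun_prop) (by fun_prop)).2 h

/-- If the residual `V - a(Z)` is independent of `Z`, then `I(U; V | Z) = I(Z, U; V - a(Z))`. -/
theorem condMutualInfo_eq_mutualInfo {Ω A C : Type*} [MeasurableSpace Ω] [MeasurableSpace A]
    [MeasurableSpace C] [StandardBorelSpace A] [Nonempty A] {n : ℕ} (P : Measure Ω)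
    [IsProbabilityMeasure P] {U : Ω → A} {V : Ω → EuclideanSpace ℝ (Fin n)} {Z : Ω → C}
    (hU : Measurable U) (hV : Measurable V) (hZ : Measurable Z)
    {a : C → EuclideanSpace ℝ (Fin n)} (ha : Measurable a)
    (h : IndepFun Z (fun ω => V ω - a (Z ω)) P) :
    condMutualInfo P U V Z =
      mutualInfo P (fun ω => (Z ω, U ω)) (fun ω => V ω - a (Z ω)) := by
  let R : Ω → EuclideanSpace ℝ (Fin n) := fun ω => V ω - a (Z ω)
  have hR : Measurable R := by fun_prop
  have : IsProbabilityMeasure (P.map R) := Measure.isProbabilityMeasure_map hR.aemeasurable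
  have : IsProbabilityMeasure (P.map Z) := Measure.isProbabilityMeasure_map hZ.aemeasurable
  have : IsProbabilityMeasure (P.map fun ω => (Z ω, U ω)) :=
    Measure.isProbabilityMeasure_map (by fun_prop)
  have : IsProbabilityMeasure (P.map fun ω => ((Z ω, U ω), R ω)) :=
    Measure.isProbabilityMeasure_map (by fun_prop)
  let s : C × EuclideanSpace ℝ (Fin n) → EuclideanSpace ℝ (Fin n) := fun w => w.2 + a w.1
  have hs : Measurable s := by fun_prop
  -- The law of `R + a(x)`; by independence it is the conditional law of `V` given `Z = x`.
  let κ : Kernel C (EuclideanSpace ℝ (Fin n)) :=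
    (Kernel.id ×ₖ Kernel.const C (P.map R)).map s
  have : IsMarkovKernel κ := Kernel.IsMarkovKernel.map _ hs
  have hκ : ∀ (x : C) {f : EuclideanSpace ℝ (Fin n) → ℝ≥0∞}, Measurable f →
      ∫⁻ v, f v ∂(κ x) = ∫⁻ r, f (r + a x) ∂(P.map R) := by
    intro x f hf
    rw [Kernel.map_apply _ hs, Kernel.prod_apply, lintegral_map hf hs,
      lintegral_prod (fun w => f (s w)) (by fun_prop), Kernel.id_apply, Kernel.const_apply,
      lintegral_dirac' _ (Measurable.lintegral_prod_right' (f := fun w => f (s w)) (by fun_prop))]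
  have hprod := (indepFun_iff_map_prod_eq_prod_map_map hZ.aemeasurable hR.aemeasurable).1 h
  have hdis : P.map (fun ω => (Z ω, V ω)) = P.map Z ⊗ₘ κ := by
    refine Measure.ext_of_lintegral _ fun f hf => ?_
    rw [lintegral_map hf (by fun_prop), Measure.lintegral_compProd hf]
    simp_rw [fun x => hκ x (f := fun v => f (x, v)) (by fun_prop)]
    rw [← lintegral_prod (μ := P.map Z) (ν := P.map R) (fun w => f (w.1, w.2 + a w.1))
      (by fun_prop), ← hprod, lintegral_map (by fun_prop) (by fun_prop)]
    simp [R]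
  have hcond : condDistrib U Z P ×ₖ condDistrib V Z P =ᵐ[P.map Z] condDistrib U Z P ×ₖ κ := by
    filter_upwards [condDistrib_ae_eq_of_measure_eq_compProd Z hV.aemeasurable hdis] with x hx
    rw [Kernel.prod_apply, Kernel.prod_apply, hx]
  -- Adding `a(z)` back is a bijection with inverse `Ψ`. It carries both measures defining the
  -- mutual information with the residual to those defining the conditional one.
  let Φ : (C × A) × EuclideanSpace ℝ (Fin n) → C × A × EuclideanSpace ℝ (Fin n) :=
    fun w => (w.1.1, w.1.2, w.2 + a w.1.1)
  let Ψ : C × A × EuclideanSpace ℝ (Fin n) → (C × A) × EuclideanSpace ℝ (Fin n) :=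
    fun w => ((w.1, w.2.1), w.2.2 - a w.1)
  have hΦ : Measurable Φ := by fun_prop
  have hΨ : Measurable Ψ := by fun_prop
  have h1 : P.map (fun ω => (Z ω, U ω, V ω)) = (P.map fun ω => ((Z ω, U ω), R ω)).map Φ := by
    rw [Measure.map_map hΦ (by fun_prop)]
    congr 1
    ext1 ω
    simp [Φ, R]
  have h2 : P.map Z ⊗ₘ (condDistrib U Z P ×ₖ condDistrib V Z P) =
      ((P.map fun ω => (Z ω, U ω)).prod (P.map R)).map Φ := by
    rw [Measure.compProd_congr hcond]
    refine Measure.ext_of_lintegral _ fun f hf => ?_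
    rw [Measure.lintegral_compProd hf, lintegral_map hf hΦ,
      lintegral_prod (fun w => f (Φ w)) (by fun_prop), ← compProd_map_condDistrib hU.aemeasurable,
      Measure.lintegral_compProd
        (Measurable.lintegral_prod_right' (f := fun w => f (Φ w)) (by fun_prop))]
    refine lintegral_congr fun x => ?_
    rw [Kernel.prod_apply, lintegral_prod _ (by fun_prop)]
    refine lintegral_congr fun u => ?_
    rw [hκ x (by fun_prop)]
  rw [condMutualInfo, mutualInfo, h1, h2]
  refine klDiv_map_eq_of_ae_leftInverse hΦ hΨ ?_ ?_ <;>
  exact Filter.Eventually.of_forall fun w => by simp [Φ, Ψ]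

variable {E F : Type*} [NormedAddCommGroup E] [NormedSpace ℝ E] [FiniteDimensional ℝ E]
  [MeasurableSpace E] [BorelSpace E]
  [NormedAddCommGroup F] [NormedSpace ℝ F] [FiniteDimensional ℝ F]
  [MeasurableSpace F] [BorelSpace F] {n k : ℕ}

/-- The whitening `y ↦ S (y - m)` turns the law of `M` into a standard Gaussian, possibly of lower
dimension, and is undone almost surely by `v ↦ T v + m`. -/
theorem mutualInfo_eq_affineDiv (μ : Measure E) [IsProbabilityMeasure μ] (X : E →L[ℝ] F)
    (M : E →L[ℝ] EuclideanSpace ℝ (Fin n)) {m : EuclideanSpace ℝ (Fin n)}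
    {T : EuclideanSpace ℝ (Fin k) →L[ℝ] EuclideanSpace ℝ (Fin n)}
    {S : EuclideanSpace ℝ (Fin n) →L[ℝ] EuclideanSpace ℝ (Fin k)} (hST : ∀ v, S (T v) = v)
    (hM : μ.map M = (stdGaussian _).map fun v => T v + m) :
    mutualInfo μ X M = affineDiv μ X (S ∘L M) (-(S m)) := by
  let g : F × EuclideanSpace ℝ (Fin n) → F × EuclideanSpace ℝ (Fin k) :=
    Prod.map id fun y => S y + -(S m)
  let g' : F × EuclideanSpace ℝ (Fin k) → F × EuclideanSpace ℝ (Fin n) :=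
    Prod.map id fun v => T v + m
  have hg : Measurable g := by fun_prop
  have hg' : Measurable g' := by fun_prop
  have : IsProbabilityMeasure (μ.map M) := Measure.isProbabilityMeasure_map (by fun_prop)
  have : IsProbabilityMeasure (μ.map X) := Measure.isProbabilityMeasure_map (by fun_prop)
  have : IsProbabilityMeasure (μ.map fun x => (X x, M x)) :=
    Measure.isProbabilityMeasure_map (by fun_prop)
  have hae : ∀ᵐ y ∂(μ.map M), T (S y + -(S m)) + m = y := by
    rw [hM, ae_map_iff (by fun_prop) (measurableSet_eq_fun (by fun_prop) (by fun_prop))]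
    exact Filter.Eventually.of_forall fun v => by simp [hST]
  have hstd : (μ.map M).map (fun y => S y + -(S m)) = stdGaussian _ := by
    rw [hM, Measure.map_map (by fun_prop) (by fun_prop)]
    have : (fun y => S y + -(S m)) ∘ (fun v => T v + m) = id := by
      ext1 v
      simp [hST]
    rw [this, Measure.map_id]
  rw [mutualInfo, ← klDiv_map_eq_of_ae_leftInverse hg hg', affineDiv]
  · congr 1
    · rw [Measure.map_map hg (by fun_prop)]
      rfl
    · rw [← Measure.map_prod_map _ _ measurable_id (by fun_prop), Measure.map_id, hstd]
  · rw [ae_map_iff (by fun_prop) (measurableSet_eq_fun (by fun_prop) (by fun_prop))]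
    filter_upwards [ae_of_ae_map M.continuous.aemeasurable hae] with x hx
    exact Prod.ext rfl hx
  · filter_upwards [Measure.quasiMeasurePreserving_snd.ae hae] with w hw
    exact Prod.ext rfl hw

variable {d₁ d₂ dY : ℕ}

/-- Since `M` has the same law under all feasible `q`, one whitening serves them all and the
objective becomes a single `affineDiv`. -/
theorem exists_isMinOn_mutualInfo {p : Law d₁ d₂ dY} (hp : p ∈ pairwiseGaussian d₁ d₂ dY)
    (X : Triple d₁ d₂ dY →L[ℝ] F) (M : Triple d₁ d₂ dY →L[ℝ] EuclideanSpace ℝ (Fin n))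
    (hG : IsGaussian ((p : Measure (Triple d₁ d₂ dY)).map M))
    (hM : ∀ q ∈ feasible p, (q : Measure (Triple d₁ d₂ dY)).map M =
      (p : Measure (Triple d₁ d₂ dY)).map M) :
    ∃ q ∈ feasible p, IsJointlyGaussian q ∧
      IsMinOn (fun q : Law d₁ d₂ dY => mutualInfo (q : Measure (Triple d₁ d₂ dY)) X M)
        (feasible p) q := by
  obtain ⟨k, T, S, m, hST, hstd⟩ := exists_standardization ((p : Measure (Triple d₁ d₂ dY)).map M)
  obtain ⟨q, hq, hqG, hmin⟩ := exists_isMinOn_affineDiv hp X (S ∘L M) (-(S m))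
  have key : ∀ q ∈ feasible p, mutualInfo (q : Measure (Triple d₁ d₂ dY)) X M =
      affineDiv (q : Measure (Triple d₁ d₂ dY)) X (S ∘L M) (-(S m)) := fun q hq =>
    mutualInfo_eq_affineDiv _ X M hST ((hM q hq).trans hstd)
  refine ⟨q, hq, hqG, fun q' hq' => ?_⟩
  change mutualInfo _ X M ≤ mutualInfo _ X M
  rw [key q hq, key q' hq']
  exact hmin hq'

end MutualInfo

/-! ### Gaussian optimizers -/

section Optimizers

variable {d₁ d₂ dY : ℕ}

theorem exists_isMinOn_totalInfo {p : Law d₁ d₂ dY} (hp : p ∈ pairwiseGaussian d₁ d₂ dY) :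
    ∃ q ∈ feasible p, IsJointlyGaussian q ∧ IsMinOn totalInfo (feasible p) q := by
  let X : Triple d₁ d₂ dY →L[ℝ] EuclideanSpace ℝ (Fin d₁) × EuclideanSpace ℝ (Fin d₂) :=
    (ContinuousLinearMap.fst ℝ _ _).prod
      ((ContinuousLinearMap.fst ℝ _ _) ∘L (ContinuousLinearMap.snd ℝ _ _))
  let N : EuclideanSpace ℝ (Fin d₂) × EuclideanSpace ℝ (Fin dY) →L[ℝ] EuclideanSpace ℝ (Fin dY) :=
    ContinuousLinearMap.snd ℝ _ _
  have hN : ∀ q : Law d₁ d₂ dY, (q : Measure (Triple d₁ d₂ dY)).map (N ∘L proj₂) =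
      (marginal₂ q).map N := fun q => by
    rw [marginal₂_eq, Measure.map_map N.continuous.measurable proj₂.continuous.measurable]
    rfl
  refine exists_isMinOn_mutualInfo hp X (N ∘L proj₂) ?_ fun q hq => ?_
  · have : IsGaussian (marginal₂ p) := hp.2
    rw [hN]
    infer_instance
  · rw [hN, hN, hq.2.2]

/-- The regression `A` of `Y` on `X₂` is read off the second marginal, which all feasible laws
share. Hence `Y - A X₂` is independent of `X₂`, with a fixed Gaussian law, even when `q` is not
jointly Gaussian. -/
theorem exists_isMinOn_condInfo₁ {p : Law d₁ d₂ dY} (hp : p ∈ pairwiseGaussian d₁ d₂ dY) :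
    ∃ q ∈ feasible p, IsJointlyGaussian q ∧ IsMinOn condInfo₁ (feasible p) q := by
  have hG : IsGaussian (marginal₂ p) := hp.2
  obtain ⟨A, hA⟩ := exists_indepFun_regression (marginal₂ p)
  let X : Triple d₁ d₂ dY →L[ℝ] EuclideanSpace ℝ (Fin d₂) × EuclideanSpace ℝ (Fin d₁) :=
    ((ContinuousLinearMap.fst ℝ _ _) ∘L (ContinuousLinearMap.snd ℝ _ _)).prod
      (ContinuousLinearMap.fst ℝ _ _)
  let N : EuclideanSpace ℝ (Fin d₂) × EuclideanSpace ℝ (Fin dY) →L[ℝ] EuclideanSpace ℝ (Fin dY) :=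
    ContinuousLinearMap.snd ℝ _ _ - A ∘L ContinuousLinearMap.fst ℝ _ _
  have hN : ∀ q : Law d₁ d₂ dY, (q : Measure (Triple d₁ d₂ dY)).map (N ∘L proj₂) =
      (marginal₂ q).map N := fun q => by
    rw [marginal₂_eq, Measure.map_map N.continuous.measurable proj₂.continuous.measurable]
    rfl
  obtain ⟨q, hq, hqG, hmin⟩ := exists_isMinOn_mutualInfo hp X (N ∘L proj₂)
    (by rw [hN]; infer_instance) fun q hq => by rw [hN, hN, hq.2.2]
  have key : ∀ q ∈ feasible p, condInfo₁ q =
      mutualInfo (q : Measure (Triple d₁ d₂ dY)) X (N ∘L proj₂) := by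
    intro q hq
    refine condMutualInfo_eq_mutualInfo (q : Measure (Triple d₁ d₂ dY)) (U := X₁) (V := Y)
      (Z := X₂) (by unfold X₁; fun_prop) (by unfold Y; fun_prop) (by unfold X₂; fun_prop)
      A.continuous.measurable ?_
    rw [← hq.2.2, marginal₂_eq] at hA
    have h := indepFun_comp_of_indepFun_map proj₂.continuous.measurable measurable_fst
      (by fun_prop) hA
    exact h
  refine ⟨q, hq, hqG, fun q' hq' => ?_⟩
  change condInfo₁ q ≤ condInfo₁ q'
  rw [key q hq, key q' hq']
  exact hmin hq'

theorem exists_isMinOn_condInfo₂ {p : Law d₁ d₂ dY} (hp : p ∈ pairwiseGaussian d₁ d₂ dY) :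
    ∃ q ∈ feasible p, IsJointlyGaussian q ∧ IsMinOn condInfo₂ (feasible p) q := by
  have hG : IsGaussian (marginal₁ p) := hp.1
  obtain ⟨A, hA⟩ := exists_indepFun_regression (marginal₁ p)
  let X : Triple d₁ d₂ dY →L[ℝ] EuclideanSpace ℝ (Fin d₁) × EuclideanSpace ℝ (Fin d₂) :=
    (ContinuousLinearMap.fst ℝ _ _).prod
      ((ContinuousLinearMap.fst ℝ _ _) ∘L (ContinuousLinearMap.snd ℝ _ _))
  let N : EuclideanSpace ℝ (Fin d₁) × EuclideanSpace ℝ (Fin dY) →L[ℝ] EuclideanSpace ℝ (Fin dY) :=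
    ContinuousLinearMap.snd ℝ _ _ - A ∘L ContinuousLinearMap.fst ℝ _ _
  have hN : ∀ q : Law d₁ d₂ dY, (q : Measure (Triple d₁ d₂ dY)).map (N ∘L proj₁) =
      (marginal₁ q).map N := fun q => by
    rw [marginal₁_eq, Measure.map_map N.continuous.measurable proj₁.continuous.measurable]
    rfl
  obtain ⟨q, hq, hqG, hmin⟩ := exists_isMinOn_mutualInfo hp X (N ∘L proj₁)
    (by rw [hN]; infer_instance) fun q hq => by rw [hN, hN, hq.2.1]
  have key : ∀ q ∈ feasible p, condInfo₂ q =
      mutualInfo (q : Measure (Triple d₁ d₂ dY)) X (N ∘L proj₁) := by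
    intro q hq
    refine condMutualInfo_eq_mutualInfo (q : Measure (Triple d₁ d₂ dY)) (U := X₂) (V := Y)
      (Z := X₁) (by unfold X₂; fun_prop) (by unfold Y; fun_prop) (by unfold X₁; fun_prop)
      A.continuous.measurable ?_
    rw [← hq.2.1, marginal₁_eq] at hA
    have h := indepFun_comp_of_indepFun_map proj₁.continuous.measurable measurable_fst
      (by fun_prop) hA
    exact h
  refine ⟨q, hq, hqG, fun q' hq' => ?_⟩
  change condInfo₂ q ≤ condInfo₂ q'
  rw [key q hq, key q' hq']
  exact hmin hq'

/-- `I(X₁;Y)` depends only on the first marginal. Subtraction in `EReal` is antitone in its second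
argument even at infinite values, where `⊤ - ⊤ = ⊥`. -/
theorem isMaxOn_interactionInfo {p q : Law d₁ d₂ dY} (hq : q ∈ feasible p)
    (hmin : IsMinOn condInfo₁ (feasible p) q) : IsMaxOn interactionInfo (feasible p) q := by
  have key : ∀ q ∈ feasible p, mutualInfo (q : Measure (Triple d₁ d₂ dY)) X₁ Y =
      klDiv (marginal₁ p) ((marginal₁ p).fst.prod (marginal₁ p).snd) := by
    intro q hq
    rw [← hq.2.1, mutualInfo, marginal₁, Measure.fst_map_prodMk (by unfold Y; fun_prop),
      Measure.snd_map_prodMk (by unfold X₁; fun_prop)]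
  intro q' hq'
  change interactionInfo q' ≤ interactionInfo q
  rw [interactionInfo, interactionInfo, key q hq, key q' hq']
  exact EReal.sub_le_sub le_rfl (EReal.coe_ennreal_le_coe_ennreal_iff.2 (hmin hq'))

theorem gaussianFeasible_eq {p : Law d₁ d₂ dY} (hp : p ∈ pairwiseGaussian d₁ d₂ dY) :
    gaussianFeasible p = {q | q ∈ feasible p ∧ IsJointlyGaussian q} := by
  ext q
  constructor
  · rintro ⟨hG, h₁, h₂⟩
    exact ⟨⟨⟨h₁ ▸ hp.1, h₂ ▸ hp.2⟩, h₁, h₂⟩, hG⟩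
  · rintro ⟨⟨-, h₁, h₂⟩, hG⟩
    exact ⟨hG, h₁, h₂⟩

theorem iInf_eq_iInf_of_isMinOn {α : Type*} {f : α → ℝ≥0∞} {s t : Set α} (hts : t ⊆ s) {q : α}
    (hq : q ∈ t) (hmin : IsMinOn f s q) :
    ⨅ x ∈ t, (f x : EReal) = ⨅ x ∈ s, (f x : EReal) := by
  refine le_antisymm ?_ (biInf_mono hts)
  refine le_iInf₂ fun x hx => (iInf₂_le q hq).trans ?_
  exact EReal.coe_ennreal_le_coe_ennreal_iff.2 (hmin hx)

theorem tildeGpid_eq_gpid {p : Law d₁ d₂ dY} (hp : p ∈ pairwiseGaussian d₁ d₂ dY) :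
    tildeGpid p = gpid p := by
  have hsub : gaussianFeasible p ⊆ feasible p := by
    rw [gaussianFeasible_eq hp]
    exact fun q hq => hq.1
  have hmem : ∀ q ∈ feasible p, IsJointlyGaussian q → q ∈ gaussianFeasible p := fun q hq hG => by
    rw [gaussianFeasible_eq hp]
    exact ⟨hq, hG⟩
  obtain ⟨q, hq, hG, hmin⟩ := exists_isMinOn_totalInfo hp
  obtain ⟨q₁, hq₁, hG₁, hmin₁⟩ := exists_isMinOn_condInfo₁ hp
  obtain ⟨q₂, hq₂, hG₂, hmin₂⟩ := exists_isMinOn_condInfo₂ hp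
  ext1
  · refine le_antisymm (biSup_mono hsub) (iSup₂_le fun q' hq' => ?_)
    exact (isMaxOn_interactionInfo hq₁ hmin₁ hq').trans
      (le_iSup₂ (f := fun q _ => interactionInfo q) q₁ (hmem q₁ hq₁ hG₁))
  · exact iInf_eq_iInf_of_isMinOn hsub (hmem q₁ hq₁ hG₁) hmin₁
  · exact iInf_eq_iInf_of_isMinOn hsub (hmem q₂ hq₂ hG₂) hmin₂
  · exact congrArg ((totalInfo p : EReal) - ·) (iInf_eq_iInf_of_isMinOn hsub (hmem q hq hG) hmin)

end Optimizers

/-! ### Conditional differential entropy as a divergence -/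

section Entropy

/-- Differential entropy with respect to `ξ`, in terms of the divergence from a probability measure
with density `φ` with respect to `ξ`. -/
theorem entropy_eq_sub_klDiv {α : Type*} [MeasurableSpace α] {π ξ : Measure α}
    [IsProbabilityMeasure π] [SigmaFinite ξ] {φ : α → ℝ} (hφ : Measurable φ) (hφ0 : ∀ x, 0 < φ x)
    [IsProbabilityMeasure (ξ.withDensity fun x => ENNReal.ofReal (φ x))]
    (hlog : Integrable (fun x => Real.log (φ x)) π) (hac : π ≪ ξ) :
    ((∫⁻ x, ENNReal.ofReal (Real.negMulLog (π.rnDeriv ξ x).toReal) ∂ξ : ℝ≥0∞) : EReal) -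
      ((∫⁻ x, ENNReal.ofReal (-Real.negMulLog (π.rnDeriv ξ x).toReal) ∂ξ : ℝ≥0∞) : EReal) =
    ((-∫ x, Real.log (φ x) ∂π : ℝ) : EReal) -
      (klDiv π (ξ.withDensity fun x => ENNReal.ofReal (φ x)) : EReal) := by
  set γ := ξ.withDensity fun x => ENNReal.ofReal (φ x) with hγ
  have hφm : Measurable fun x => ENNReal.ofReal (φ x) := hφ.ennreal_ofReal
  have hne : ∀ᵐ x ∂ξ, ENNReal.ofReal (φ x) ≠ 0 :=
    Filter.Eventually.of_forall fun x => by simp [hφ0 x]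
  have hac' : π ≪ γ := hac.trans (withDensity_absolutelyContinuous' hφm.aemeasurable hne)
  have hllr : llr π γ =ᵐ[π] fun x => llr π ξ x - Real.log (φ x) := by
    filter_upwards [hac.ae_le (Measure.rnDeriv_withDensity_right π ξ hφm.aemeasurable hne
      (by simp)), Measure.rnDeriv_pos hac,
      hac.ae_le (Measure.rnDeriv_ne_top π ξ)] with x hx hpos htop
    rw [llr, hx, llr, ENNReal.toReal_mul, ENNReal.toReal_inv, ENNReal.toReal_ofReal (hφ0 x).le,
      Real.log_mul (inv_ne_zero (hφ0 x).ne') (ENNReal.toReal_pos hpos.ne' htop).ne', Real.log_inv]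
    ring
  have hmeas : Measurable fun x => Real.negMulLog (π.rnDeriv ξ x).toReal :=
    Real.continuous_negMulLog.measurable.comp (Measure.measurable_rnDeriv π ξ).ennreal_toReal
  have hneg : (fun x => Real.negMulLog (π.rnDeriv ξ x).toReal) =
      fun x => -((π.rnDeriv ξ x).toReal * Real.log (π.rnDeriv ξ x).toReal) := by
    ext x
    simp [Real.negMulLog]
  -- With `t` the density of `π`, `log u ≤ u - 1` at `u = φ / t` gives `-t log t ≤ φ + t |log φ|`,
  -- which is integrable. So the entropy is never `∞ - ∞`.
  have hpos : ∫⁻ x, ENNReal.ofReal (Real.negMulLog (π.rnDeriv ξ x).toReal) ∂ξ ≠ ∞ := by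
    have hbound : ∀ᵐ x ∂ξ, ENNReal.ofReal (Real.negMulLog (π.rnDeriv ξ x).toReal) ≤
        ENNReal.ofReal (φ x) + π.rnDeriv ξ x * ENNReal.ofReal |Real.log (φ x)| := by
      filter_upwards [Measure.rnDeriv_ne_top π ξ] with x hx
      obtain ⟨t, ht, hxt⟩ : ∃ t : ℝ, 0 ≤ t ∧ π.rnDeriv ξ x = ENNReal.ofReal t :=
        ⟨_, ENNReal.toReal_nonneg, (ENNReal.ofReal_toReal hx).symm⟩
      rw [hxt, ENNReal.toReal_ofReal ht, ← ENNReal.ofReal_mul ht,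
        ← ENNReal.ofReal_add (hφ0 x).le (by positivity)]
      apply ENNReal.ofReal_le_ofReal
      rcases ht.eq_or_lt with rfl | ht
      · simp [(hφ0 x).le]
      · have h1 := Real.log_le_sub_one_of_pos (div_pos (hφ0 x) ht)
        rw [Real.log_div (hφ0 x).ne' ht.ne'] at h1
        have h2 := mul_le_mul_of_nonneg_left h1 ht.le
        have h3 : t * (φ x / t - 1) = φ x - t := by field_simp
        have h4 := mul_le_mul_of_nonneg_left (neg_abs_le (Real.log (φ x))) ht.le
        rw [Real.negMulLog]
        linarith
    refine ((lintegral_mono_ae hbound).trans_lt ?_).ne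
    rw [lintegral_add_left hφm, lintegral_rnDeriv_mul hac (by fun_prop)]
    refine ENNReal.add_lt_top.2 ⟨?_, ?_⟩
    · have h := measure_lt_top γ Set.univ
      rwa [hγ, withDensity_apply _ MeasurableSet.univ, Measure.restrict_univ] at h
    · exact (hasFiniteIntegral_iff_ofReal (Filter.Eventually.of_forall fun _ => abs_nonneg _)).1
        hlog.abs.2
  by_cases hInt : Integrable (llr π γ) π
  · have hInt' : Integrable (llr π ξ) π := by
      refine ((hInt.congr hllr).add hlog).congr (Filter.Eventually.of_forall fun x => ?_)
      simp
    have hH : Integrable (fun x => Real.negMulLog (π.rnDeriv ξ x).toReal) ξ := by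
      rw [hneg]
      exact ((integrable_rnDeriv_mul_log_iff hac).2 hInt').neg
    have hnegfin : ∫⁻ x, ENNReal.ofReal (-Real.negMulLog (π.rnDeriv ξ x).toReal) ∂ξ ≠ ∞ :=
      hH.neg.lintegral_lt_top.ne
    have h1 := integral_eq_lintegral_pos_part_sub_lintegral_neg_part hH
    have h2 : ∫ x, Real.negMulLog (π.rnDeriv ξ x).toReal ∂ξ = -∫ x, llr π ξ x ∂π := by
      rw [hneg, integral_neg, integral_rnDeriv_mul_log hac]
    have h3 : ∫ x, llr π γ x ∂π = ∫ x, llr π ξ x ∂π - ∫ x, Real.log (φ x) ∂π := by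
      rw [integral_congr_ae hllr, integral_sub hInt' hlog]
    have hkl := klDiv_ne_top hac' hInt
    have h4 := toReal_klDiv_of_measure_eq hac' (by simp)
    rw [← EReal.coe_ennreal_toReal hpos, ← EReal.coe_ennreal_toReal hnegfin,
      ← EReal.coe_ennreal_toReal hkl, ← EReal.coe_sub, ← EReal.coe_sub, ← h1, h4, h2, h3]
    congr 1
    ring
  -- The positive part being finite, failure of integrability can only come from the negative part;
  -- both sides are then `-∞`.
  · have hnegtop : ∫⁻ x, ENNReal.ofReal (-Real.negMulLog (π.rnDeriv ξ x).toReal) ∂ξ = ∞ := by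
      by_contra hcon
      apply hInt
      have hH : Integrable (fun x => Real.negMulLog (π.rnDeriv ξ x).toReal) ξ := by
        refine ⟨hmeas.aestronglyMeasurable, ?_⟩
        rw [hasFiniteIntegral_iff_norm]
        have : ∀ x, ENNReal.ofReal ‖Real.negMulLog (π.rnDeriv ξ x).toReal‖ =
            ENNReal.ofReal (Real.negMulLog (π.rnDeriv ξ x).toReal) +
              ENNReal.ofReal (-Real.negMulLog (π.rnDeriv ξ x).toReal) := by
          intro x
          rcases le_total 0 (Real.negMulLog (π.rnDeriv ξ x).toReal) with h | h
          · rw [Real.norm_of_nonneg h, ENNReal.ofReal_of_nonpos (neg_nonpos.2 h), add_zero]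
          · rw [Real.norm_of_nonpos h, ENNReal.ofReal_of_nonpos h, zero_add]
        simp_rw [this]
        rw [lintegral_add_left hmeas.ennreal_ofReal]
        exact ENNReal.add_lt_top.2 ⟨hpos.lt_top, lt_top_iff_ne_top.2 hcon⟩
      have hInt' : Integrable (llr π ξ) π := by
        rw [hneg] at hH
        refine (integrable_rnDeriv_mul_log_iff hac).1 (hH.neg.congr ?_)
        exact Filter.Eventually.of_forall fun x => by simp
      exact (hInt'.sub hlog).congr hllr.symm
    rw [hnegtop, klDiv_of_not_integrable hInt]
    simp

/-- The previous identity with `φ` the standard Gaussian density in the second variable, whose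
expected negative logarithm is the real constant here. Without a conditional density both sides are
`⊥`. -/
theorem condDiffEntropy_eq_sub_klDiv {Ω A : Type*} [MeasurableSpace Ω] [MeasurableSpace A] {n : ℕ}
    (P : Measure Ω) [IsProbabilityMeasure P] {V : Ω → EuclideanSpace ℝ (Fin n)} {U : Ω → A}
    (hV : Measurable V) (hU : Measurable U) (hsq : Integrable (fun ω => ‖V ω‖ ^ 2) P) :
    condDiffEntropy P V U =
      ((n / 2 * Real.log (2 * Real.pi) + 1 / 2 * ∫ ω, ‖V ω‖ ^ 2 ∂P : ℝ) : EReal) -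
      (klDiv (P.map fun ω => (U ω, V ω)) ((P.map U).prod (stdGaussian _)) : EReal) := by
  have : IsProbabilityMeasure (P.map U) := Measure.isProbabilityMeasure_map (by fun_prop)
  have : IsProbabilityMeasure (P.map fun ω => (U ω, V ω)) :=
    Measure.isProbabilityMeasure_map (by fun_prop)
  let φ : A × EuclideanSpace ℝ (Fin n) → ℝ := fun z => stdGaussianDensity z.2
  have hφ : Measurable φ := by fun_prop
  have hprod : (P.map U).prod (stdGaussian _) =
      ((P.map U).prod volume).withDensity fun z => ENNReal.ofReal (φ z) := by
    rw [stdGaussian_eq_withDensity, prod_withDensity_right (by fun_prop)]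
  have : IsProbabilityMeasure
      (((P.map U).prod volume).withDensity fun z => ENNReal.ofReal (φ z)) := by
    rw [← hprod]
    infer_instance
  rw [condDiffEntropy, hprod]
  split_ifs with hac
  · have hlog : Integrable (fun z => Real.log (φ z)) (P.map fun ω => (U ω, V ω)) := by
      rw [integrable_map_measure hφ.log.aestronglyMeasurable (by fun_prop)]
      simp only [Function.comp_def, φ, log_stdGaussianDensity]
      exact (integrable_const _).sub (hsq.const_mul _)
    refine (entropy_eq_sub_klDiv hφ (fun w => stdGaussianDensity_pos w.2) hlog hac).trans ?_
    congr 2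
    rw [integral_map (by fun_prop) hφ.log.aestronglyMeasurable]
    simp only [φ, log_stdGaussianDensity]
    rw [integral_sub (integrable_const _) (hsq.const_mul _), integral_const, integral_const_mul]
    simp
    ring
  · rw [klDiv_of_not_ac fun h => hac (h.trans (withDensity_absolutelyContinuous _ _))]
    simp

variable {d₁ d₂ dY : ℕ}

/-- The projection `(x₁, x₂, y) ↦ (x₁, x₂)`. -/
def projX : Triple d₁ d₂ dY →L[ℝ] EuclideanSpace ℝ (Fin d₁) × EuclideanSpace ℝ (Fin d₂) :=
  (ContinuousLinearMap.fst ℝ _ _).prod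
    ((ContinuousLinearMap.fst ℝ _ _) ∘L (ContinuousLinearMap.snd ℝ _ _))

/-- The projection `(x₁, x₂, y) ↦ y`. -/
def projY : Triple d₁ d₂ dY →L[ℝ] EuclideanSpace ℝ (Fin dY) :=
  (ContinuousLinearMap.snd ℝ _ _) ∘L (ContinuousLinearMap.snd ℝ _ _)

theorem entropyYGivenX_eq {q : Law d₁ d₂ dY} (hq : HasFiniteMoments q) :
    entropyYGivenX q =
      ((dY / 2 * Real.log (2 * Real.pi) + 1 / 2 * sqMoment projY 0
        (∫ z, z ∂(q : Measure (Triple d₁ d₂ dY)))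
        (covarianceBilinDual (q : Measure (Triple d₁ d₂ dY))) : ℝ) : EReal) -
      (affineDiv (q : Measure (Triple d₁ d₂ dY)) projX projY 0 : EReal) := by
  have hsq := integrable_norm_sq_affine hq projY 0
  have hsq' := integral_norm_sq_affine hq projY 0
  simp only [add_zero] at hsq hsq'
  have h := condDiffEntropy_eq_sub_klDiv (q : Measure (Triple d₁ d₂ dY))
    projY.continuous.measurable projX.continuous.measurable hsq
  rw [hsq'] at h
  refine Eq.trans h ?_
  simp only [affineDiv, add_zero]

/-- The real term depends only on the shared moments, and the subtracted divergence is least for the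
Gaussian law. -/
theorem entropyYGivenX_le_of_isGaussianMatch {q q' : Law d₁ d₂ dY} (hq : HasFiniteMoments q)
    (h : IsGaussianMatch q q') : entropyYGivenX q ≤ entropyYGivenX q' := by
  obtain ⟨hG, hm, hc⟩ := h
  have : IsGaussian (q' : Measure (Triple d₁ d₂ dY)) := hG
  have hq' : HasFiniteMoments q' := IsGaussian.memLp_two_id
  rw [entropyYGivenX_eq hq, entropyYGivenX_eq hq', hm, hc]
  exact EReal.sub_le_sub le_rfl (EReal.coe_ennreal_le_coe_ennreal_iff.2
    (affineDiv_le_of_moments_eq hq hm hc _ _ _))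

theorem exists_isGaussianMatch (q : Law d₁ d₂ dY) : ∃ q' : Law d₁ d₂ dY, IsGaussianMatch q q' := by
  obtain ⟨μ, hμ, hm, hc⟩ := exists_isGaussian_of_isCovForm
    (∫ z, z ∂(q : Measure (Triple d₁ d₂ dY)))
    (isCovForm_covarianceBilinDual (q : Measure (Triple d₁ d₂ dY)))
  exact ⟨⟨μ, inferInstance⟩, hμ, hm, hc⟩

end Entropy

end

end GPID

theorem lemma3p2 (d₁ d₂ dY : ℕ) :
    -- the Gaussian law with the same moments exists and has the larger conditional entropy
    (∀ q : GPID.Law d₁ d₂ dY, GPID.HasFiniteMoments q →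
      (∃ q' : GPID.Law d₁ d₂ dY, GPID.IsGaussianMatch q q') ∧
      ∀ q' : GPID.Law d₁ d₂ dY, GPID.IsGaussianMatch q q' →
        GPID.entropyYGivenX q ≤ GPID.entropyYGivenX q') ∧
    -- GPID has jointly Gaussian optimizers, and equals the Gaussian-restricted decomposition
    (∀ p ∈ GPID.pairwiseGaussian d₁ d₂ dY,
      (∃ q ∈ GPID.feasible p, GPID.IsJointlyGaussian q ∧
        IsMinOn GPID.totalInfo (GPID.feasible p) q) ∧
      (∃ q ∈ GPID.feasible p, GPID.IsJointlyGaussian q ∧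
        IsMinOn GPID.condInfo₁ (GPID.feasible p) q) ∧
      (∃ q ∈ GPID.feasible p, GPID.IsJointlyGaussian q ∧
        IsMinOn GPID.condInfo₂ (GPID.feasible p) q) ∧
      (∃ q ∈ GPID.feasible p, GPID.IsJointlyGaussian q ∧
        IsMaxOn GPID.interactionInfo (GPID.feasible p) q) ∧
      GPID.tildeGpid p = GPID.gpid p) := by
  refine ⟨fun q hq => ⟨GPID.exists_isGaussianMatch q,
    fun q' h => GPID.entropyYGivenX_le_of_isGaussianMatch hq h⟩, fun p hp => ?_⟩
  refine ⟨GPID.exists_isMinOn_totalInfo hp, GPID.exists_isMinOn_condInfo₁ hp,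
    GPID.exists_isMinOn_condInfo₂ hp, ?_, GPID.tildeGpid_eq_gpid hp⟩
  obtain ⟨q, hq, hG, hmin⟩ := GPID.exists_isMinOn_condInfo₁ hp
  exact ⟨q, hq, hG, GPID.isMaxOn_interactionInfo hq hmin⟩
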